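/- Let $\mathcal C\subseteq\mathbb F_2^n$ be a binary linear code of dimension $k$ that has a parity-check matrix whose Tanner graph is a tree, and assume that no coordinate vanishes on all of $\mathcal C$. Let $\theta_1,\dots,\theta_n\in(0,\pi)$. A uniformly random codeword $x\in\mathcal C$ is sent over $W[\theta_1]\otimes\dots\otimes W[\theta_n]$, where $W[\theta]$ maps a bit $b$ to the qubit state $|b,\theta\rangle=\cos\frac\theta2|0\rangle+(-1)^b\sin\frac\theta2|1\rangle$; the output is $|\Psi_x\rangle=\bigotimes_j|x_j,\theta_j\rangle$. Put $\rho=2^{-k}\sum_{x\in\mathcal C}|\Psi_x\rangle\langle\Psi_x|$; the pretty-good measurement (PGM) has the elements $E_x=2^{-k}\rho^{-1/2}|\Psi_x\rangle\langle\Psi_x|\rho^{-1/2}$, $x\in\mathcal C$ (inverse on the support), and the remainder $1-\sum_xE_x$. *Message-passing graph (MPG) with respect to bit $r$.* Regard each bit node of the Tanner graph as an equality node with an additional leaf, the channel node $\theta_j$ of the bit. Replace all nodes of degree larger than three by trees of nodes of degree three of the same type, suppress nodes of degree two, put an equality node, the root, on the edge to the leaf $\theta_r$, direct all edges to the root, and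 order the two predecessors of each inner node. (If $n=1$, the leaf is the whole MPG.) All choices are arbitrary. *Single-bit unitary $V_r$.* The leaf $\theta_j$ passes on the $j$-th channel output qubit. An inner node acts on the two qubits received from its first and second predecessor, passes the first one on and keeps the second one as an ancilla. A check node applies CNOT, controlled by the first qubit. An equality node applies, uniformly controlled by the ancillas of the preceding check nodes, $$U(\alpha,\beta)=\begin{pmatrix}a_+&0&0&a_-\\-a_-&0&0&a_+\\0&b_-&b_+&0\\0&b_+&-b_-&0\end{pmatrix},\quad a_\pm=\frac{\cos\frac{\alpha-\beta}2\pm\cos\frac{\alpha+\beta}2}{2|\cos\frac{\alpha\circledast\beta}2|},\quad b_\pm=\frac{\sin\frac{\alpha+\beta}2\pm\sin\frac{\alpha-\beta}2}{2|\sin\frac{\alpha\circledast\beta}2|},$$ where $\alpha,\beta$ are the angles of its predecessors in the branch given by the ancilla values: a leaf has angle $\theta_j$, an equality node with predecessor angles $\alpha,\beta$ has angle $\alpha\circledast\beta=\arccos(\cos\alpha\cos\beta)$, and a check node with ancilla value $l$ has angle $\arccos\frac{\cos\alpha+(-1)^l\cos\beta}{1+(-1)^l\cos\alpha\cos\beta}$.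 *BPQM.* Let $r_1,\dots,r_k$ be positions whose bits determine the codeword and are independent, in any order. For $i=1,\dots,k$ in turn, apply $V_{r_i}$ of an MPG of $\mathcal C$ with respect to $r_i$, measure the qubit passed on by the root in the basis $|\pm\rangle$ (outcome $0$ for $|+\rangle$, $1$ for $|-\rangle$), and apply $V_{r_i}^\dagger$. Output the unique codeword whose bits at $r_1,\dots,r_k$ are the outcomes. Let $K_y$ be the product of the operators applied when the output is $y\in\mathcal C$, so that the measurement has the elements $K_y^\dagger K_y$. **Theorem.** The states $|\Psi_x\rangle$, $x\in\mathcal C$, are linearly independent and geometrically uniform (they form the orbit of one vector under a finite abelian group of unitaries). The PGM elements are mutually orthogonal projections, and the PGM is block optimal: no measurement with outcomes in $\mathcal C$ (and possibly a failure outcome) identifies $x$ with a higher average success probability. Every bit has an MPG, and for every choice of the positions $r_i$ and of the MPGs, all $V_{r_i}$ are unitary, BPQM realizes the PGM on the channel outputs, that is, $$K_y|\Psi_x\rangle=E_y|\Psi_x\rangle,\qquad \langle\Psi_x|K_y^\dagger K_y|\Psi_x\rangle=\langle\Psi_x|E_y|\Psi_x\rangle\qquad(x,y\in\mathcal C),$$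 $\sum_{y}K_y^\dagger K_y=1$, and BPQM is block optimal. -/

import Mathlib

/-!
Binary linear codes with tree Tanner graphs, message-passing graphs, the BPQM decoder for
pure-state classical-quantum channels, and the pretty-good measurement.

An `n`-qubit vector is a function on computational basis labels `Fin n → ZMod 2`.
-/

noncomputable section

namespace BPQM

open scoped ComplexOrder

/-! ### Tanner graphs -/

/-- The Tanner graph of a parity-check matrix: bit nodes on the left, check nodes on the right. -/
def tannerGraph {m n : ℕ} (H : Matrix (Fin m) (Fin n) (ZMod 2)) :
    SimpleGraph (Fin n ⊕ Fin m) where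
  Adj
    | .inl j, .inr c => H c j ≠ 0
    | .inr c, .inl j => H c j ≠ 0
    | _, _ => False
  symm := ⟨by rintro (a | a) (b | b) h <;> exact h⟩
  loopless := ⟨by rintro (a | a) h <;> exact h⟩

/-- `H` is a parity-check matrix of `C` whose Tanner graph is a tree. -/
def IsTreeParityCheck {m n : ℕ} (C : Submodule (ZMod 2) (Fin n → ZMod 2))
    (H : Matrix (Fin m) (Fin n) (ZMod 2)) : Prop :=
  (∀ x, x ∈ C ↔ H.mulVec x = 0) ∧ (tannerGraph H).IsTree

/-- The code has some Tanner graph that is a tree. -/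
def HasTreeTannerGraph {n : ℕ} (C : Submodule (ZMod 2) (Fin n → ZMod 2)) : Prop :=
  ∃ (m : ℕ) (H : Matrix (Fin m) (Fin n) (ZMod 2)), IsTreeParityCheck C H

/-- The codeword bits at the positions `r 0, …, r (k-1)` are independent and determine the
codeword. -/
def IsInformationSet {n k : ℕ} (C : Submodule (ZMod 2) (Fin n → ZMod 2)) (r : Fin k → Fin n) :
    Prop :=
  Function.Bijective (fun (x : C) (i : Fin k) => x.1 (r i))

/-! ### Message-passing graphs -/

/-- Full binary trees whose leaves are channel nodes and whose inner nodes are equality or check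
nodes; the order of the arguments is the order of the two predecessors of a node. -/
inductive MPG (n : ℕ) : Type
  | leaf (j : Fin n) : MPG n
  | eq (a b : MPG n) : MPG n
  | check (a b : MPG n) : MPG n

/-- `Combines op s T`: `T` arises by joining the trees in the multiset `s`, in some order and
bracketing, by binary nodes `op`. This is the replacement of a node of arbitrary degree, seen from
its edge towards the root, by nodes of degree three. For a single tree (a node of degree two) no
node is left. -/
inductive Combines {n : ℕ} (op : MPG n → MPG n → MPG n) : Multiset (MPG n) → MPG n → Prop
  | single (T : MPG n) : Combines op {T} T
  | join {s t : Multiset (MPG n)} {A B : MPG n} :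
      Combines op s A → Combines op t B → Combines op (s + t) (op A B)

/-- `Branch H p v T`: `T` is a binary tree for the part of the factor graph that lies behind the
Tanner node `v`, seen from its neighbour `p`, which is closer to the root. A bit node is an equality
node that has the channel node of the bit as an additional neighbour. -/
inductive Branch {m n : ℕ} (H : Matrix (Fin m) (Fin n) (ZMod 2)) :
    Fin n ⊕ Fin m → Fin n ⊕ Fin m → MPG n → Prop
  | bit (c : Fin m) (j : Fin n) (f : Fin m → MPG n) (T : MPG n) :
      (∀ c', H c' j ≠ 0 → c' ≠ c → Branch H (.inl j) (.inr c') (f c')) →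
      Combines MPG.eq
        (MPG.leaf j ::ₘ (Finset.univ.filter fun c' => H c' j ≠ 0 ∧ c' ≠ c).val.map f) T →
      Branch H (.inr c) (.inl j) T
  | check (j : Fin n) (c : Fin m) (f : Fin n → MPG n) (T : MPG n) :
      (∀ j', H c j' ≠ 0 → j' ≠ j → Branch H (.inr c) (.inl j') (f j')) →
      Combines MPG.check ((Finset.univ.filter fun j' => H c j' ≠ 0 ∧ j' ≠ j).val.map f) T →
      Branch H (.inl j) (.inr c) T

/-- `T` is built from the Tanner graph of `H` with an equality node on the edge of the `r`-th
codeword bit as its root. The root joins the channel node of that bit to the rest of the graph; if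
there is no rest (a bit in no check), the channel node is the whole tree. -/
def IsMPGFrom {m n : ℕ} (H : Matrix (Fin m) (Fin n) (ZMod 2)) (r : Fin n) (T : MPG n) : Prop :=
  ∃ f : Fin m → MPG n,
    (∀ c, H c r ≠ 0 → Branch H (.inl r) (.inr c) (f c)) ∧
    (((∀ c, H c r = 0) ∧ T = MPG.leaf r) ∨
      ∃ B, Combines MPG.eq ((Finset.univ.filter fun c => H c r ≠ 0).val.map f) B ∧
        (T = MPG.eq (MPG.leaf r) B ∨ T = MPG.eq B (MPG.leaf r)))

/-- `T` is a message-passing graph of the code `C` with respect to its `r`-th bit. -/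
def IsMPG {n : ℕ} (C : Submodule (ZMod 2) (Fin n → ZMod 2)) (r : Fin n) (T : MPG n) : Prop :=
  ∃ (m : ℕ) (H : Matrix (Fin m) (Fin n) (ZMod 2)), IsTreeParityCheck C H ∧ IsMPGFrom H r T

/-! ### Channel outputs -/

/-- The qubit state `cos (φ/2) |0⟩ + (-1)^x sin (φ/2) |1⟩`, the output of `W[φ]` on input `x`. -/
def qstate (φ : ℝ) (x z : ZMod 2) : ℂ :=
  if z = 0 then (Real.cos (φ / 2) : ℂ) else (-1) ^ x.val * (Real.sin (φ / 2) : ℂ)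

/-- The output of `W[θ₁] ⊗ ⋯ ⊗ W[θₙ]` on input `x`. -/
def outputState {n : ℕ} (θ : Fin n → ℝ) (x : Fin n → ZMod 2) : (Fin n → ZMod 2) → ℂ :=
  fun z => ∏ i, qstate (θ i) (x i) (z i)

/-- The operator `|ψ⟩⟨ψ|`. -/
def ketbra {ι : Type*} (ψ : ι → ℂ) : Matrix ι ι ℂ := Matrix.vecMulVec ψ (star ψ)

/-! ### Gates -/

/-- The single-qubit operator `A` on qubit `d`. -/
def onQubit {n : ℕ} (d : Fin n) (A : Matrix (ZMod 2) (ZMod 2) ℂ) :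
    Matrix (Fin n → ZMod 2) (Fin n → ZMod 2) ℂ :=
  Matrix.of fun z w => if ∀ i, i ≠ d → z i = w i then A (z d) (w d) else 0

/-- The two-qubit operator `A s` on the qubits `d` (first) and `e` (second), controlled by the
computational basis state `s` (in the uses below, `A s` depends only on qubits other than
`d` and `e`). -/
def onQubits {n : ℕ} (d e : Fin n)
    (A : (Fin n → ZMod 2) → Matrix (ZMod 2 × ZMod 2) (ZMod 2 × ZMod 2) ℂ) :
    Matrix (Fin n → ZMod 2) (Fin n → ZMod 2) ℂ :=
  Matrix.of fun z w =>
    if ∀ i, i ≠ d → i ≠ e → z i = w i then A w (z d, z e) (w d, w e) else 0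

/-- The CNOT gate; the first qubit is the control. -/
def cnot : Matrix (ZMod 2 × ZMod 2) (ZMod 2 × ZMod 2) ℂ :=
  Matrix.of fun p q => if p.1 = q.1 ∧ p.2 = q.2 + q.1 then 1 else 0

/-- The angle `φ ⊛ φ'`. -/
def eqAngle (φ φ' : ℝ) : ℝ := Real.arccos (Real.cos φ * Real.cos φ')

/-- The angle `φ ⊠_l φ'`. -/
def checkAngle (l : ZMod 2) (φ φ' : ℝ) : ℝ :=
  Real.arccos ((Real.cos φ + (-1) ^ l.val * Real.cos φ') /
    (1 + (-1) ^ l.val * (Real.cos φ * Real.cos φ')))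

def aPlus (α β : ℝ) : ℝ :=
  1 / 2 * ((Real.cos ((α - β) / 2) + Real.cos ((α + β) / 2)) / |Real.cos (eqAngle α β / 2)|)

def aMinus (α β : ℝ) : ℝ :=
  1 / 2 * ((Real.cos ((α - β) / 2) - Real.cos ((α + β) / 2)) / |Real.cos (eqAngle α β / 2)|)

def bPlus (α β : ℝ) : ℝ :=
  1 / 2 * ((Real.sin ((α + β) / 2) + Real.sin ((α - β) / 2)) / |Real.sin (eqAngle α β / 2)|)

def bMinus (α β : ℝ) : ℝ :=
  1 / 2 * ((Real.sin ((α + β) / 2) - Real.sin ((α - β) / 2)) / |Real.sin (eqAngle α β / 2)|)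

/-- The position of a two-qubit basis label in the order `00, 01, 10, 11`. -/
def pairIndex (p : ZMod 2 × ZMod 2) : Fin 4 := Fin.ofNat 4 (2 * p.1.val + p.2.val)

/-- The equality node unitary `U_⊛(α, β)`. -/
def eqUnitary (α β : ℝ) : Matrix (ZMod 2 × ZMod 2) (ZMod 2 × ZMod 2) ℂ :=
  Matrix.of fun p q =>
    (((!![aPlus α β, 0, 0, aMinus α β;
          -aMinus α β, 0, 0, aPlus α β;
          0, bMinus α β, bPlus α β, 0;
          0, bPlus α β, -bMinus α β, 0] : Matrix (Fin 4) (Fin 4) ℝ)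
        (pairIndex p) (pairIndex q) : ℝ) : ℂ)

/-! ### The BPQM circuit -/

/-- The wire of the data qubit that a node passes on: both node operations pass on their first
qubit and leave the second one behind as an ancilla. -/
def MPG.dataWire {n : ℕ} : MPG n → Fin n
  | .leaf j => j
  | .eq a _ => a.dataWire
  | .check a _ => a.dataWire

/-- The branch list of a node as a function: the angle that belongs to the values `s` of the
ancilla qubits left behind by the check nodes up to this node. The ancilla of `check a b` is the
wire `b.dataWire`; no other qubits of `s` are read. -/
def MPG.angle {n : ℕ} (θ : Fin n → ℝ) : MPG n → (Fin n → ZMod 2) → ℝ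
  | .leaf j, _ => θ j
  | .eq a b, s => eqAngle (a.angle θ s) (b.angle θ s)
  | .check a b, s => checkAngle (s b.dataWire) (a.angle θ s) (b.angle θ s)

/-- The unitary `V` of all node operations, from the leaves to the root. -/
def MPG.circuit {n : ℕ} (θ : Fin n → ℝ) :
    MPG n → Matrix (Fin n → ZMod 2) (Fin n → ZMod 2) ℂ
  | .leaf _ => 1
  | .eq a b =>
      onQubits a.dataWire b.dataWire (fun s => eqUnitary (a.angle θ s) (b.angle θ s)) *
        (a.circuit θ * b.circuit θ)
  | .check a b =>
      onQubits a.dataWire b.dataWire (fun _ => cnot) * (a.circuit θ * b.circuit θ)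

def hadamard : Matrix (ZMod 2) (ZMod 2) ℂ :=
  Matrix.of fun a b => ((1 / Real.sqrt 2 : ℝ) : ℂ) * (-1) ^ (a.val * b.val)

/-- The projection for outcome `b` of the measurement in the `|±⟩` basis. -/
def pmProjection (b : ZMod 2) : Matrix (ZMod 2) (ZMod 2) ℂ :=
  hadamard * Matrix.single b b 1 * hadamard

/-- Decoding of one bit with outcome `b`: apply `V`, measure the data qubit in the `|±⟩` basis,
rewind by `V†`. -/
def bitStep {n : ℕ} (θ : Fin n → ℝ) (T : MPG n) (b : ZMod 2) :
    Matrix (Fin n → ZMod 2) (Fin n → ZMod 2) ℂ :=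
  (T.circuit θ).conjTranspose * onQubit T.dataWire (pmProjection b) * T.circuit θ

/-- The operator `K_b` of the sequential decoder for the outcome string `b`; the bit with index `0`
is decoded first. -/
def bpqmOperator {n k : ℕ} (θ : Fin n → ℝ) (T : Fin k → MPG n) (b : Fin k → ZMod 2) :
    Matrix (Fin n → ZMod 2) (Fin n → ZMod 2) ℂ :=
  (List.ofFn fun i => bitStep θ (T i) (b i)).reverse.prod

/-- The POVM element `K†K` with which BPQM outputs the codeword `x`, that is, with which the
outcomes are the bits of `x` at the positions `r`. -/
def bpqmElement {n k : ℕ} {C : Submodule (ZMod 2) (Fin n → ZMod 2)} (θ : Fin n → ℝ)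
    (r : Fin k → Fin n) (T : Fin k → MPG n) (x : C) :
    Matrix (Fin n → ZMod 2) (Fin n → ZMod 2) ℂ :=
  (bpqmOperator θ T fun i => x.1 (r i)).conjTranspose * bpqmOperator θ T fun i => x.1 (r i)

/-! ### Block decoding -/

/-- The average output state of a uniformly random codeword. -/
def averageState {n : ℕ} (C : Submodule (ZMod 2) (Fin n → ZMod 2)) [Fintype C]
    (θ : Fin n → ℝ) : Matrix (Fin n → ZMod 2) (Fin n → ZMod 2) ℂ :=
  ∑ x : C, ((Fintype.card C : ℂ)⁻¹) • ketbra (outputState θ x.1)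

/-- `ρ^{-1/2}`, with the inverse taken on the support (`(√0)⁻¹ = 0`). -/
def invSqrt {ι : Type*} [Fintype ι] [DecidableEq ι] (ρ : Matrix ι ι ℂ) : Matrix ι ι ℂ :=
  cfc (fun t : ℝ => (Real.sqrt t)⁻¹) ρ

/-- The pretty-good measurement of the equally likely codeword output states. -/
def pgmElement {n : ℕ} (C : Submodule (ZMod 2) (Fin n → ZMod 2)) [Fintype C]
    (θ : Fin n → ℝ) (x : C) : Matrix (Fin n → ZMod 2) (Fin n → ZMod 2) ℂ :=
  ((Fintype.card C : ℂ)⁻¹) •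
    (invSqrt (averageState C θ) * ketbra (outputState θ x.1) * invSqrt (averageState C θ))

/-- A block decoder: a measurement whose outcomes are the codewords and possibly one further
outcome, failure, with the element `1 - ∑ x, E x`. -/
def IsDecoder {n : ℕ} (C : Submodule (ZMod 2) (Fin n → ZMod 2)) [Fintype C]
    (E : C → Matrix (Fin n → ZMod 2) (Fin n → ZMod 2) ℂ) : Prop :=
  (∀ x, (E x).PosSemidef) ∧ (1 - ∑ x, E x).PosSemidef

/-- The probability that a uniformly random codeword is decoded correctly. -/
def successProb {n : ℕ} (C : Submodule (ZMod 2) (Fin n → ZMod 2)) [Fintype C]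
    (θ : Fin n → ℝ) (E : C → Matrix (Fin n → ZMod 2) (Fin n → ZMod 2) ℂ) : ℝ :=
  (Fintype.card C : ℝ)⁻¹ * ∑ x : C, (E x * ketbra (outputState θ x.1)).trace.re

/-- Block optimality: no decoder has a higher success probability. -/
def IsBlockOptimal {n : ℕ} (C : Submodule (ZMod 2) (Fin n → ZMod 2)) [Fintype C]
    (θ : Fin n → ℝ) (E : C → Matrix (Fin n → ZMod 2) (Fin n → ZMod 2) ℂ) : Prop :=
  IsDecoder C E ∧ ∀ F, IsDecoder C F → successProb C θ F ≤ successProb C θ E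

/-- A set of vectors is geometrically uniform if it is the orbit of a vector under a finite abelian
group of unitaries. -/
def IsGeometricallyUniform {ι : Type*} [Fintype ι] [DecidableEq ι] (S : Set (ι → ℂ)) : Prop :=
  ∃ (G : Subgroup (Matrix.unitaryGroup ι ℂ)) (φ : ι → ℂ),
    (G : Set (Matrix.unitaryGroup ι ℂ)).Finite ∧ (∀ U ∈ G, ∀ V ∈ G, U * V = V * U) ∧
      S = {ψ | ∃ U ∈ G, ψ = (U : Matrix ι ι ℂ).mulVec φ}

end BPQM

end

noncomputable section

namespace BPQM

open Matrix

section Gates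

/-! ### Gates -/

/-! The amplitude of |Ψ_x⟩ at the label z is (-1)^{x·z} times a positive number that does not depend
on x (`outputState_apply`). The sign depends only on the class of z modulo the dual code, and an
information set identifies these classes with F_2^k (`dualClass`). Hence |Ψ_x⟩ = ∑_s (-1)^{m·s} ν_s
u_s, where m is the information string of x, the unit vectors u_s have disjoint supports, and ν_s >
0 (`outputState_eq_fourierState`).

The PGM is now Fourier analysis on F_2^k. Each u_s is an eigenvector of ρ with eigenvalue ν_s², so
ρ^{-1/2} replaces all ν_s by 1, and the PGM measures in the orthogonal Fourier basis w_m = ∑_s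
(-1)^{m·s} u_s (`pgm_eq_fourierProj`). It succeeds with probability 2^{-k} (∑ ν_s)², and a weighted
Cauchy–Schwarz inequality bounds every other measurement by this value (`sum_star_dotProduct_le`).

For BPQM, a message-passing graph defines an F_2-linear map `syndrome` on labels: an equality node
moves the sum of its two bits to the data wire and clears the ancilla, a check node acts as CNOT.
The angles are such that each gate sends the part of the incoming vector with a common image to a
multiple of that image; by induction V sends the part with syndrome s to a multiple of |s⟩
(`circuit_mulVec_syndromeVec`). The transpose `encode` of this map has the code as its range, and
its argument at the data wire is the bit at the root. So the fibres of the syndrome are the classes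
modulo the dual code, V sends each u_s to a basis state, and flipping the label at r flips the data
wire. Measuring and rewinding therefore acts on the span of the u_s as (1 + (-1)^b X_i)/2 with X_i
u_s = u_{s+e_i}. The vectors w_m are common eigenvectors, with eigenvalue 1 if b = m_i and 0
otherwise: earlier steps do not disturb later ones, and the product of all steps is, on this span,
the PGM projection.

That the Tanner graph is a tree enters in `IsMPG.represents`: every bit is exactly one leaf, so the
gates of different branches act on different wires, and the equality nodes of the graph are
satisfied exactly by the codewords. -/

/-- The label `w` with the values at `d` and `e` replaced by `p`. -/
def setPair {n : ℕ} (d e : Fin n) (w : Fin n → ZMod 2) (p : ZMod 2 × ZMod 2) : Fin n → ZMod 2 :=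
  Function.update (Function.update w d p.1) e p.2

section setPair

variable {n : ℕ} {d e : Fin n}

@[simp] lemma setPair_fst (h : d ≠ e) (w : Fin n → ZMod 2) (p) : setPair d e w p d = p.1 := by
  simp [setPair, h]

@[simp] lemma setPair_snd (w : Fin n → ZMod 2) (p) : setPair d e w p e = p.2 := by
  simp [setPair]

lemma setPair_of_ne (w : Fin n → ZMod 2) (p) {i : Fin n} (hd : i ≠ d) (he : i ≠ e) :
    setPair d e w p i = w i := by
  simp [setPair, hd, he]

lemma eq_setPair_iff (h : d ≠ e) (z w : Fin n → ZMod 2) (p : ZMod 2 × ZMod 2) :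
    z = setPair d e w p ↔ (∀ i, i ≠ d → i ≠ e → z i = w i) ∧ (z d, z e) = p := by
  constructor
  · rintro rfl
    exact ⟨fun i hd he => setPair_of_ne _ _ hd he, by simp [h]⟩
  · rintro ⟨h1, rfl⟩
    funext i
    by_cases hd : i = d
    · subst hd; simp [h]
    by_cases he : i = e
    · subst he; simp
    rw [setPair_of_ne _ _ hd he, h1 i hd he]

lemma setPair_self (h : d ≠ e) (w : Fin n → ZMod 2) : setPair d e w (w d, w e) = w :=
  ((eq_setPair_iff h _ _ _).2 ⟨fun _ _ _ => rfl, rfl⟩).symm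

lemma sum_agree_off_pair {M : Type*} [AddCommMonoid M] (h : d ≠ e) (w : Fin n → ZMod 2)
    (F : (Fin n → ZMod 2) → M) :
    (∑ z, if ∀ i, i ≠ d → i ≠ e → z i = w i then F z else 0) = ∑ p, F (setPair d e w p) := by
  rw [← Finset.sum_filter]
  refine Finset.sum_nbij' (fun z => (z d, z e)) (setPair d e w) (by simp) ?_ ?_ ?_ ?_
  · intro p _
    simp only [Finset.mem_filter, Finset.mem_univ, true_and]
    exact fun i hd he => setPair_of_ne _ _ hd he
  · intro z hz
    exact ((eq_setPair_iff h _ _ _).2 ⟨(Finset.mem_filter.1 hz).2, rfl⟩).symm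
  · intro p _
    simp [h]
  · intro z hz
    rw [← (eq_setPair_iff h _ _ _).2 ⟨(Finset.mem_filter.1 hz).2, rfl⟩]

lemma onQubits_mulVec (h : d ≠ e)
    (A : (Fin n → ZMod 2) → Matrix (ZMod 2 × ZMod 2) (ZMod 2 × ZMod 2) ℂ)
    (ψ : (Fin n → ZMod 2) → ℂ) (z : Fin n → ZMod 2) :
    (onQubits d e A *ᵥ ψ) z =
      ∑ p, A (setPair d e z p) (z d, z e) p * ψ (setPair d e z p) := by
  rw [mulVec, dotProduct]
  have : ∀ w, onQubits d e A z w * ψ w =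
      if ∀ i, i ≠ d → i ≠ e → w i = z i then A w (z d, z e) (w d, w e) * ψ w else 0 := by
    intro w
    simp only [onQubits, of_apply, ite_mul, zero_mul]
    simp only [eq_comm]
  simp only [this]
  rw [sum_agree_off_pair h]
  simp [h]

/-- `A` does not read the qubits `d` and `e`. -/
def IgnoresPair {α : Type*} (d e : Fin n) (A : (Fin n → ZMod 2) → α) : Prop :=
  ∀ z w, (∀ i, i ≠ d → i ≠ e → z i = w i) → A z = A w

/-- The matrix is block diagonal, with one block for each assignment to the other qubits. Since `A`
ignores `d` and `e`, it is constant on a block, which is thus a single unitary. -/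
lemma onQubits_mem_unitaryGroup (h : d ≠ e)
    (A : (Fin n → ZMod 2) → Matrix (ZMod 2 × ZMod 2) (ZMod 2 × ZMod 2) ℂ)
    (hA : IgnoresPair d e A) (hU : ∀ s, A s ∈ unitaryGroup (ZMod 2 × ZMod 2) ℂ) :
    onQubits d e A ∈ unitaryGroup (Fin n → ZMod 2) ℂ := by
  rw [mem_unitaryGroup_iff']
  ext w w'
  rw [star_eq_conjTranspose, mul_apply]
  have key : ∀ z, (onQubits d e A)ᴴ w z * onQubits d e A z w' =
      if ∀ i, i ≠ d → i ≠ e → z i = w i then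
        (if ∀ i, i ≠ d → i ≠ e → w i = w' i then
          star (A w (z d, z e) (w d, w e)) * A w' (z d, z e) (w' d, w' e) else 0) else 0 := by
    intro z
    simp only [conjTranspose_apply, onQubits, of_apply]
    by_cases h1 : ∀ i, i ≠ d → i ≠ e → z i = w i
    · have : (∀ i, i ≠ d → i ≠ e → z i = w' i) ↔ ∀ i, i ≠ d → i ≠ e → w i = w' i := by
        refine forall₃_congr fun i hd he => ?_
        rw [h1 i hd he]
      simp only [this]
      rw [if_pos h1, if_pos h1]
      split_ifs <;> simp
    · rw [if_neg h1, if_neg h1]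
      simp
  simp only [key]
  rw [sum_agree_off_pair h]
  simp only [setPair_fst h, setPair_snd]
  by_cases h2 : ∀ i, i ≠ d → i ≠ e → w i = w' i
  · rw [hA w w' h2]
    have h3 := congrFun (congrFun ((mem_unitaryGroup_iff').1 (hU w')) (w d, w e)) (w' d, w' e)
    rw [star_eq_conjTranspose, mul_apply] at h3
    simp only [conjTranspose_apply] at h3
    simp only [if_pos h2]
    rw [h3, one_apply, one_apply]
    have : w = w' ↔ (w d, w e) = (w' d, w' e) := by
      constructor
      · rintro rfl; rfl
      · intro h4
        rw [(eq_setPair_iff h w w' _).2 ⟨h2, h4⟩, setPair_self h]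
    simp only [this]
  · simp only [if_neg h2, Finset.sum_const_zero]
    rw [one_apply, if_neg]
    rintro rfl
    exact h2 fun _ _ _ => rfl

end setPair

/-- The sign `(-1)^a`. -/
def sgn (a : ZMod 2) : ℂ := (-1) ^ a.val

lemma zmod_two_cases (a : ZMod 2) : a = 0 ∨ a = 1 := by
  revert a; decide

lemma sgn_zero : sgn 0 = 1 := by simp [sgn]

lemma sgn_one : sgn 1 = -1 := by
  have : (1 : ZMod 2).val = 1 := rfl
  simp [sgn, this]

lemma one_add_one_zmod_two : (1 : ZMod 2) + 1 = 0 := by decide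

lemma sgn_add (a b : ZMod 2) : sgn (a + b) = sgn a * sgn b := by
  rcases zmod_two_cases a with rfl | rfl <;> rcases zmod_two_cases b with rfl | rfl <;>
    simp [sgn_zero, sgn_one, one_add_one_zmod_two]

lemma sgn_mul_self (a : ZMod 2) : sgn a * sgn a = 1 := by
  rcases zmod_two_cases a with rfl | rfl <;> simp [sgn_zero, sgn_one]

lemma star_sgn (a : ZMod 2) : star (sgn a) = sgn a := by
  rcases zmod_two_cases a with rfl | rfl <;> simp [sgn_zero, sgn_one]

lemma sum_zmod_two {M : Type*} [AddCommMonoid M] (f : ZMod 2 → M) : ∑ a, f a = f 0 + f 1 :=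
  Fin.sum_univ_two f

lemma pmProjection_apply (b x y : ZMod 2) : pmProjection b x y = 1 / 2 * sgn (b * (x + y)) := by
  have h2 : ((Real.sqrt 2 : ℝ) : ℂ) * (Real.sqrt 2 : ℝ) = 2 := by
    rw [← Complex.ofReal_mul, Real.mul_self_sqrt (by norm_num)]; norm_num
  have h3 : ((Real.sqrt 2 : ℝ) : ℂ)⁻¹ * ((Real.sqrt 2 : ℝ) : ℂ)⁻¹ = 1 / 2 := by
    rw [← mul_inv, h2]; norm_num
  have h4 : ((1 / Real.sqrt 2 : ℝ) : ℂ) * ((1 / Real.sqrt 2 : ℝ) : ℂ) = 1 / 2 := by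
    push_cast; rw [one_div, h3]
  have hs : ∀ a c : ZMod 2, ((-1 : ℂ)) ^ (a.val * c.val) = sgn (a * c) := by
    intro a c
    rcases zmod_two_cases a with rfl | rfl <;> rcases zmod_two_cases c with rfl | rfl <;>
      simp [sgn, ZMod.val_one]
  have : pmProjection b x y = hadamard x b * hadamard b y := by
    simp only [pmProjection, mul_apply, Matrix.single_apply, sum_zmod_two]
    rcases zmod_two_cases b with rfl | rfl <;> simp
  rw [this]
  simp only [hadamard, of_apply, hs]
  rw [mul_mul_mul_comm, h4, ← sgn_add]
  congr 2
  ring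

lemma pmProjection_conjTranspose (b : ZMod 2) : (pmProjection b)ᴴ = pmProjection b := by
  ext x y
  simp only [conjTranspose_apply, pmProjection_apply, star_mul', star_sgn, add_comm y x]
  simp

lemma sum_agree_off {M : Type*} [AddCommMonoid M] {n : ℕ} (d : Fin n) (w : Fin n → ZMod 2)
    (F : (Fin n → ZMod 2) → M) :
    (∑ z, if ∀ i, i ≠ d → z i = w i then F z else 0) = ∑ a, F (Function.update w d a) := by
  rw [← Finset.sum_filter]
  have key : ∀ z, (∀ i, i ≠ d → z i = w i) → Function.update w d (z d) = z := by
    intro z hz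
    funext i
    by_cases hi : i = d
    · subst hi; simp
    · simp [hi, hz i hi]
  refine Finset.sum_nbij' (fun z => z d) (Function.update w d) (by simp) ?_ ?_ ?_ ?_
  · intro p _
    simp +contextual
  · intro z hz
    exact key z (Finset.mem_filter.1 hz).2
  · intro p _
    simp
  · intro z hz
    rw [key z (Finset.mem_filter.1 hz).2]

lemma onQubit_conjTranspose_mul_self {n : ℕ} (d : Fin n) (A : Matrix (ZMod 2) (ZMod 2) ℂ) :
    (onQubit d A)ᴴ * onQubit d A = onQubit d (Aᴴ * A) := by
  ext w w'
  rw [mul_apply]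
  have key : ∀ z, (onQubit d A)ᴴ w z * onQubit d A z w' =
      if ∀ i, i ≠ d → z i = w i then
        (if ∀ i, i ≠ d → w i = w' i then star (A (z d) (w d)) * A (z d) (w' d) else 0)
      else 0 := by
    intro z
    simp only [conjTranspose_apply, onQubit, of_apply]
    by_cases h1 : ∀ i, i ≠ d → z i = w i
    · have : (∀ i, i ≠ d → z i = w' i) ↔ ∀ i, i ≠ d → w i = w' i := by
        refine forall₂_congr fun i hd => ?_
        rw [h1 i hd]
      simp only [this]
      rw [if_pos h1, if_pos h1]
      split_ifs <;> simp
    · rw [if_neg h1, if_neg h1]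
      simp
  simp only [key]
  rw [sum_agree_off]
  simp only [onQubit, of_apply, mul_apply, conjTranspose_apply, Function.update_self]
  split_ifs <;> simp

lemma sum_onQubit_pmProjection {n : ℕ} (d : Fin n) :
    ∑ b, (onQubit d (pmProjection b))ᴴ * onQubit d (pmProjection b) = 1 := by
  have h1 : ∑ b, (pmProjection b)ᴴ * pmProjection b = 1 := by
    ext x y
    simp only [pmProjection_conjTranspose, sum_zmod_two, Matrix.add_apply, mul_apply,
      pmProjection_apply]
    rcases zmod_two_cases x with rfl | rfl <;> rcases zmod_two_cases y with rfl | rfl <;>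
      simp [sgn_zero, sgn_one, one_add_one_zmod_two] <;> norm_num
  ext z w
  have h2 := congrFun (congrFun h1 (z d)) (w d)
  simp only [onQubit_conjTranspose_mul_self]
  rw [Matrix.sum_apply] at h2 ⊢
  simp only [onQubit, of_apply]
  by_cases h : ∀ i, i ≠ d → z i = w i
  · simp only [if_pos h, h2, one_apply]
    have : z = w ↔ z d = w d := by
      refine ⟨fun h => h ▸ rfl, fun h' => funext fun i => ?_⟩
      by_cases hi : i = d
      · subst hi; exact h'
      · exact h i hi
    simp only [this]
  · simp only [if_neg h, Finset.sum_const_zero]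
    rw [one_apply, if_neg]
    rintro rfl
    exact h fun _ _ => rfl

/-- The projection is (1 + (-1)^b X)/2 with the bit flip X. In this form it can be compared with
translations of F_2^k. -/
lemma onQubit_pmProjection_mulVec_single {n : ℕ} (d : Fin n) (b : ZMod 2) (s : Fin n → ZMod 2) :
    onQubit d (pmProjection b) *ᵥ Pi.single s 1 =
      (1 / 2 : ℂ) • (Pi.single s 1 + sgn b • Pi.single (s + Pi.single d 1) 1) := by
  ext z
  rw [mulVec_single_one, col_apply]
  simp only [onQubit, of_apply, Pi.smul_apply, Pi.add_apply, smul_eq_mul, pmProjection_apply]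
  by_cases h : ∀ i, i ≠ d → z i = s i
  · have h0 : z = s ↔ z d = s d := by
      refine ⟨fun h => h ▸ rfl, fun h' => funext fun i => ?_⟩
      by_cases hi : i = d
      · subst hi; exact h'
      · exact h i hi
    have h1 : z = s + Pi.single d 1 ↔ z d = s d + 1 := by
      refine ⟨fun h => by simp [h], fun h' => funext fun i => ?_⟩
      by_cases hi : i = d
      · subst hi; simp [h']
      · simp [hi, h i hi]
    rw [if_pos h, Pi.single_apply, Pi.single_apply]
    simp only [h0, h1]
    rcases zmod_two_cases (z d) with hz | hz <;> rcases zmod_two_cases (s d) with hs | hs <;>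
      simp [hz, hs, one_add_one_zmod_two, sgn_zero]
  · rw [if_neg h, Pi.single_apply, Pi.single_apply, if_neg, if_neg]
    · simp
    · rintro rfl; exact h fun i hi => by simp [hi]
    · rintro rfl; exact h fun i hi => rfl

lemma cnot_mem_unitaryGroup : cnot ∈ unitaryGroup (ZMod 2 × ZMod 2) ℂ := by
  rw [mem_unitaryGroup_iff']
  ext ⟨a, b⟩ ⟨c, d⟩
  rw [star_eq_conjTranspose, mul_apply]
  simp only [conjTranspose_apply, cnot, of_apply, Fintype.sum_prod_type, sum_zmod_two, one_apply]
  rcases zmod_two_cases a with rfl | rfl <;> rcases zmod_two_cases b with rfl | rfl <;>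
  rcases zmod_two_cases c with rfl | rfl <;> rcases zmod_two_cases d with rfl | rfl <;>
    simp [one_add_one_zmod_two]

end Gates

section Amplitudes

/-! ### Amplitudes and angles -/

/-- The absolute value of the amplitude of the state with angle `φ` at the label `a`. -/
def amp (φ : ℝ) (a : ZMod 2) : ℝ := if a = 0 then Real.cos (φ / 2) else Real.sin (φ / 2)

lemma amp_pos {φ : ℝ} (h : φ ∈ Set.Ioo 0 Real.pi) (a : ZMod 2) : 0 < amp φ a := by
  unfold amp
  split_ifs
  · exact Real.cos_pos_of_mem_Ioo ⟨by linarith [h.1, Real.pi_pos], by linarith [h.2]⟩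
  · exact Real.sin_pos_of_pos_of_lt_pi (by linarith [h.1]) (by linarith [h.1, h.2])

@[simp] lemma amp_zero (φ : ℝ) : amp φ 0 = Real.cos (φ / 2) := by simp [amp]

@[simp] lemma amp_one (φ : ℝ) : amp φ 1 = Real.sin (φ / 2) := by simp [amp]

/-- The cosine of an angle in the open upper half circle lies strictly between `-1` and `1`. -/
lemma cos_mem_Ioo {φ : ℝ} (h : φ ∈ Set.Ioo 0 Real.pi) : Real.cos φ ∈ Set.Ioo (-1) 1 := by
  constructor
  · rw [← Real.cos_pi]
    exact Real.cos_lt_cos_of_nonneg_of_le_pi h.1.le le_rfl h.2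
  · rw [← Real.cos_zero]
    exact Real.cos_lt_cos_of_nonneg_of_le_pi le_rfl h.2.le h.1

lemma arccos_mem_Ioo {x : ℝ} (h : x ∈ Set.Ioo (-1) 1) : Real.arccos x ∈ Set.Ioo 0 Real.pi := by
  refine ⟨Real.arccos_pos.2 h.2, lt_of_le_of_ne (Real.arccos_le_pi x) fun h' => ?_⟩
  rw [Real.arccos_eq_pi] at h'
  linarith [h.1]

lemma mul_mem_Ioo {x y : ℝ} (hx : x ∈ Set.Ioo (-1) 1) (hy : y ∈ Set.Ioo (-1) 1) :
    x * y ∈ Set.Ioo (-1) 1 := by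
  rw [Set.mem_Ioo, ← abs_lt] at *
  rw [abs_mul]
  nlinarith [abs_nonneg x, abs_nonneg y]

lemma eqAngle_mem {α β : ℝ} (hα : α ∈ Set.Ioo 0 Real.pi) (hβ : β ∈ Set.Ioo 0 Real.pi) :
    eqAngle α β ∈ Set.Ioo 0 Real.pi :=
  arccos_mem_Ioo (mul_mem_Ioo (cos_mem_Ioo hα) (cos_mem_Ioo hβ))

lemma cos_eqAngle {α β : ℝ} (hα : α ∈ Set.Ioo 0 Real.pi) (hβ : β ∈ Set.Ioo 0 Real.pi) :
    Real.cos (eqAngle α β) = Real.cos α * Real.cos β := by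
  have h := mul_mem_Ioo (cos_mem_Ioo hα) (cos_mem_Ioo hβ)
  exact Real.cos_arccos h.1.le h.2.le

lemma neg_one_pow_val (l : ZMod 2) : ((-1 : ℝ) ^ l.val) = 1 ∨ ((-1 : ℝ) ^ l.val) = -1 := by
  rcases zmod_two_cases l with rfl | rfl
  · simp
  · right; simp [ZMod.val_one]

lemma checkAngle_denom_pos {α β : ℝ} (hα : α ∈ Set.Ioo 0 Real.pi) (hβ : β ∈ Set.Ioo 0 Real.pi)
    (l : ZMod 2) : 0 < 1 + (-1) ^ l.val * (Real.cos α * Real.cos β) := by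
  have h := mul_mem_Ioo (cos_mem_Ioo hα) (cos_mem_Ioo hβ)
  rcases neg_one_pow_val l with e | e <;> rw [e] <;> linarith [h.1, h.2]

lemma checkAngle_quot_mem {α β : ℝ} (hα : α ∈ Set.Ioo 0 Real.pi) (hβ : β ∈ Set.Ioo 0 Real.pi)
    (l : ZMod 2) : (Real.cos α + (-1) ^ l.val * Real.cos β) /
      (1 + (-1) ^ l.val * (Real.cos α * Real.cos β)) ∈ Set.Ioo (-1) 1 := by
  have hp := checkAngle_denom_pos hα hβ l
  have h1 := cos_mem_Ioo hα
  have h2 := cos_mem_Ioo hβ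
  rw [Set.mem_Ioo, lt_div_iff₀ hp, div_lt_one hp]
  -- Without the denominator, the distances to -1 and 1 factor as (1 ± cos α)(1 ± cos β).
  rcases neg_one_pow_val l with e | e <;> rw [e] <;> constructor <;>
    nlinarith [mul_pos (sub_pos.2 h1.1) (sub_pos.2 h2.1), mul_pos (sub_pos.2 h1.2) (sub_pos.2 h2.1),
      mul_pos (sub_pos.2 h1.1) (sub_pos.2 h2.2), mul_pos (sub_pos.2 h1.2) (sub_pos.2 h2.2)]

lemma checkAngle_mem {α β : ℝ} (hα : α ∈ Set.Ioo 0 Real.pi) (hβ : β ∈ Set.Ioo 0 Real.pi)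
    (l : ZMod 2) : checkAngle l α β ∈ Set.Ioo 0 Real.pi :=
  arccos_mem_Ioo (checkAngle_quot_mem hα hβ l)

lemma cos_checkAngle {α β : ℝ} (hα : α ∈ Set.Ioo 0 Real.pi) (hβ : β ∈ Set.Ioo 0 Real.pi)
    (l : ZMod 2) : Real.cos (checkAngle l α β) = (Real.cos α + (-1) ^ l.val * Real.cos β) /
      (1 + (-1) ^ l.val * (Real.cos α * Real.cos β)) := by
  have h := checkAngle_quot_mem hα hβ l
  exact Real.cos_arccos h.1.le h.2.le

lemma cos_half_sq (φ : ℝ) : Real.cos (φ / 2) ^ 2 = (1 + Real.cos φ) / 2 := by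
  have := Real.cos_sq (φ / 2)
  rw [mul_div_cancel₀ _ (two_ne_zero)] at this
  linarith

lemma sin_half_sq (φ : ℝ) : Real.sin (φ / 2) ^ 2 = (1 - Real.cos φ) / 2 := by
  have := Real.sin_sq_add_cos_sq (φ / 2)
  linarith [cos_half_sq φ]

/-- The angle `eqAngle` is the one for which label 0 carries the total weight of 00 and 11 in the
product state; below, label 1 carries that of 01 and 10. -/
lemma cos_half_eqAngle_sq {α β : ℝ} (hα : α ∈ Set.Ioo 0 Real.pi) (hβ : β ∈ Set.Ioo 0 Real.pi) :
    Real.cos (eqAngle α β / 2) ^ 2 =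
      (Real.cos (α / 2) * Real.cos (β / 2)) ^ 2 + (Real.sin (α / 2) * Real.sin (β / 2)) ^ 2 := by
  rw [mul_pow, mul_pow]
  simp only [cos_half_sq, sin_half_sq, cos_eqAngle hα hβ]
  ring

lemma sin_half_eqAngle_sq {α β : ℝ} (hα : α ∈ Set.Ioo 0 Real.pi) (hβ : β ∈ Set.Ioo 0 Real.pi) :
    Real.sin (eqAngle α β / 2) ^ 2 =
      (Real.sin (α / 2) * Real.cos (β / 2)) ^ 2 + (Real.cos (α / 2) * Real.sin (β / 2)) ^ 2 := by
  rw [mul_pow, mul_pow]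
  simp only [cos_half_sq, sin_half_sq, cos_eqAngle hα hβ]
  ring

/-- By the addition formulas, `aPlus` and `aMinus` are the amplitudes of 00 and 11 in the product
state, normalized on the even subspace; `bPlus` and `bMinus` are those of 10 and 01 on the odd one.
Half angles lie in the open first quadrant, so the absolute values can be dropped. -/
lemma aPlus_eq {α β : ℝ} (hα : α ∈ Set.Ioo 0 Real.pi) (hβ : β ∈ Set.Ioo 0 Real.pi) :
    aPlus α β =
    Real.cos (α / 2) * Real.cos (β / 2) / Real.cos (eqAngle α β / 2) := by
  have h := amp_pos (eqAngle_mem hα hβ) 0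
  rw [amp_zero] at h
  rw [aPlus, abs_of_pos h, sub_div α, add_div α, Real.cos_sub, Real.cos_add]
  ring

lemma aMinus_eq {α β : ℝ} (hα : α ∈ Set.Ioo 0 Real.pi) (hβ : β ∈ Set.Ioo 0 Real.pi) :
    aMinus α β =
    Real.sin (α / 2) * Real.sin (β / 2) / Real.cos (eqAngle α β / 2) := by
  have h := amp_pos (eqAngle_mem hα hβ) 0
  rw [amp_zero] at h
  rw [aMinus, abs_of_pos h, sub_div α, add_div α, Real.cos_sub, Real.cos_add]
  ring

lemma bPlus_eq {α β : ℝ} (hα : α ∈ Set.Ioo 0 Real.pi) (hβ : β ∈ Set.Ioo 0 Real.pi) :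
    bPlus α β =
    Real.sin (α / 2) * Real.cos (β / 2) / Real.sin (eqAngle α β / 2) := by
  have h := amp_pos (eqAngle_mem hα hβ) 1
  rw [amp_one] at h
  rw [bPlus, abs_of_pos h, sub_div α, add_div α, Real.sin_sub, Real.sin_add]
  ring

lemma bMinus_eq {α β : ℝ} (hα : α ∈ Set.Ioo 0 Real.pi) (hβ : β ∈ Set.Ioo 0 Real.pi) :
    bMinus α β =
    Real.cos (α / 2) * Real.sin (β / 2) / Real.sin (eqAngle α β / 2) := by
  have h := amp_pos (eqAngle_mem hα hβ) 1
  rw [amp_one] at h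
  rw [bMinus, abs_of_pos h, sub_div α, add_div α, Real.sin_sub, Real.sin_add]
  ring

lemma aPlus_sq_add_aMinus_sq {α β : ℝ} (hα : α ∈ Set.Ioo 0 Real.pi) (hβ : β ∈ Set.Ioo 0 Real.pi) :
    aPlus α β * aPlus α β + aMinus α β * aMinus α β = 1 := by
  have h := amp_pos (eqAngle_mem hα hβ) 0
  rw [amp_zero] at h
  rw [aPlus_eq hα hβ, aMinus_eq hα hβ]
  field_simp
  rw [cos_half_eqAngle_sq hα hβ]
  ring

lemma bPlus_sq_add_bMinus_sq {α β : ℝ} (hα : α ∈ Set.Ioo 0 Real.pi) (hβ : β ∈ Set.Ioo 0 Real.pi) :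
    bPlus α β * bPlus α β + bMinus α β * bMinus α β = 1 := by
  have h := amp_pos (eqAngle_mem hα hβ) 1
  rw [amp_one] at h
  rw [bPlus_eq hα hβ, bMinus_eq hα hβ]
  field_simp
  rw [sin_half_eqAngle_sq hα hβ]
  ring

lemma pairIndex_values : pairIndex (0, 0) = 0 ∧ pairIndex (0, 1) = 1 ∧ pairIndex (1, 0) = 2 ∧
    pairIndex (1, 1) = 3 := by decide

lemma eqUnitary_mem_unitaryGroup {α β : ℝ} (hα : α ∈ Set.Ioo 0 Real.pi)
    (hβ : β ∈ Set.Ioo 0 Real.pi) : eqUnitary α β ∈ unitaryGroup (ZMod 2 × ZMod 2) ℂ := by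
  obtain ⟨h0, h1, h2, h3⟩ := pairIndex_values
  have ha := aPlus_sq_add_aMinus_sq hα hβ
  have hb := bPlus_sq_add_bMinus_sq hα hβ
  rw [← Complex.ofReal_inj] at ha hb
  push_cast at ha hb
  rw [mem_unitaryGroup_iff']
  ext ⟨a, b⟩ ⟨c, d⟩
  rw [star_eq_conjTranspose, mul_apply]
  simp only [conjTranspose_apply, eqUnitary, of_apply, Fintype.sum_prod_type, sum_zmod_two,
    one_apply, h0, h1, h2, h3]
  rcases zmod_two_cases a with rfl | rfl <;> rcases zmod_two_cases b with rfl | rfl <;>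
  rcases zmod_two_cases c with rfl | rfl <;> rcases zmod_two_cases d with rfl | rfl <;>
    simp [h0, h1, h2, h3] <;> first | linear_combination ha | linear_combination hb | ring

/-- The action of the equality node on the labels of its two input qubits. -/
def eqMap (p : ZMod 2 × ZMod 2) : ZMod 2 × ZMod 2 := (p.1 + p.2, 0)

/-- The action of the check node on the labels of its two input qubits. -/
def checkMap (p : ZMod 2 × ZMod 2) : ZMod 2 × ZMod 2 := (p.1, p.2 + p.1)

/-- The equality node unitary merges the amplitudes of labels with equal sum. -/
lemma eqUnitary_merge {α β : ℝ} (hα : α ∈ Set.Ioo 0 Real.pi) (hβ : β ∈ Set.Ioo 0 Real.pi)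
    (q s : ZMod 2 × ZMod 2) :
    (∑ p, eqUnitary α β q p * if eqMap p = s then ((amp α p.1 * amp β p.2 : ℝ) : ℂ) else 0) =
      if q = s then (((if s.2 = 0 then amp (eqAngle α β) s.1 else 0 : ℝ)) : ℂ) else 0 := by
  obtain ⟨h0, h1, h2, h3⟩ := pairIndex_values
  have hc := amp_pos (eqAngle_mem hα hβ) 0
  have hs := amp_pos (eqAngle_mem hα hβ) 1
  rw [amp_zero] at hc
  rw [amp_one] at hs
  have e0 : aPlus α β * (Real.cos (α / 2) * Real.cos (β / 2)) +
      aMinus α β * (Real.sin (α / 2) * Real.sin (β / 2)) = Real.cos (eqAngle α β / 2) := by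
    rw [aPlus_eq hα hβ, aMinus_eq hα hβ]
    field_simp
    rw [cos_half_eqAngle_sq hα hβ]
    ring
  have e1 : -aMinus α β * (Real.cos (α / 2) * Real.cos (β / 2)) +
      aPlus α β * (Real.sin (α / 2) * Real.sin (β / 2)) = 0 := by
    rw [aPlus_eq hα hβ, aMinus_eq hα hβ]
    ring
  have e2 : bMinus α β * (Real.cos (α / 2) * Real.sin (β / 2)) +
      bPlus α β * (Real.sin (α / 2) * Real.cos (β / 2)) = Real.sin (eqAngle α β / 2) := by
    rw [bPlus_eq hα hβ, bMinus_eq hα hβ]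
    field_simp
    rw [sin_half_eqAngle_sq hα hβ]
    ring
  have e3 : bPlus α β * (Real.cos (α / 2) * Real.sin (β / 2)) +
      -bMinus α β * (Real.sin (α / 2) * Real.cos (β / 2)) = 0 := by
    rw [bPlus_eq hα hβ, bMinus_eq hα hβ]
    ring
  rw [← Complex.ofReal_inj] at e0 e1 e2 e3
  obtain ⟨a, b⟩ := q
  obtain ⟨c, d⟩ := s
  push_cast at e0 e1 e2 e3
  simp only [eqUnitary, of_apply, Fintype.sum_prod_type, sum_zmod_two, eqMap, amp_zero, amp_one,
    h0, h1, h2, h3]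
  rcases zmod_two_cases a with rfl | rfl <;> rcases zmod_two_cases b with rfl | rfl <;>
  rcases zmod_two_cases c with rfl | rfl <;> rcases zmod_two_cases d with rfl | rfl <;>
    simp [h0, h1, h2, h3, one_add_one_zmod_two] <;>
    first | linear_combination e0 | linear_combination e1 | linear_combination e2 |
      linear_combination e3

/-- Restricting the product state to labels with sum `l` leaves a qubit state with angle `checkAngle
l α β`, scaled by the square root of the probability of `l`. -/
lemma checkAngle_amp {α β : ℝ} (hα : α ∈ Set.Ioo 0 Real.pi) (hβ : β ∈ Set.Ioo 0 Real.pi)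
    (l a : ZMod 2) :
    Real.sqrt ((1 + (-1) ^ l.val * (Real.cos α * Real.cos β)) / 2) * amp (checkAngle l α β) a =
      amp α a * amp β (l + a) := by
  have hp := checkAngle_denom_pos hα hβ l
  -- Both sides are nonnegative, so squares suffice, and these are polynomial in the cosines of the
  -- full angles.
  rw [← pow_left_inj₀ (mul_nonneg (Real.sqrt_nonneg _) (amp_pos (checkAngle_mem hα hβ l) a).le)
    (mul_pos (amp_pos hα _) (amp_pos hβ _)).le two_ne_zero, mul_pow, mul_pow,
    Real.sq_sqrt (by positivity)]
  have hc := cos_checkAngle hα hβ l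
  rw [eq_div_iff hp.ne'] at hc
  rcases zmod_two_cases l with rfl | rfl <;> rcases zmod_two_cases a with rfl | rfl <;>
    simp only [ZMod.val_zero, ZMod.val_one, pow_zero, pow_one, amp_zero, amp_one, cos_half_sq,
      sin_half_sq, one_add_one_zmod_two, add_zero, zero_add] at hc ⊢ <;>
    first | linear_combination hc / 4 | linear_combination - hc / 4

/-- CNOT permutes the labels, so nothing is really merged. The form matches `eqUnitary_merge`, so
that both node types go through `onQubits_merge`. -/
lemma cnot_merge {α β : ℝ} (hα : α ∈ Set.Ioo 0 Real.pi) (hβ : β ∈ Set.Ioo 0 Real.pi)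
    (q s : ZMod 2 × ZMod 2) :
    (∑ p, cnot q p * if checkMap p = s then ((amp α p.1 * amp β p.2 : ℝ) : ℂ) else 0) =
      if q = s then ((Real.sqrt ((1 + (-1) ^ s.2.val * (Real.cos α * Real.cos β)) / 2) *
        amp (checkAngle s.2 α β) s.1 : ℝ) : ℂ) else 0 := by
  rw [checkAngle_amp hα hβ]
  obtain ⟨a, b⟩ := q
  obtain ⟨c, d⟩ := s
  simp only [cnot, of_apply, Fintype.sum_prod_type, sum_zmod_two, checkMap]
  rcases zmod_two_cases a with rfl | rfl <;> rcases zmod_two_cases b with rfl | rfl <;>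
  rcases zmod_two_cases c with rfl | rfl <;> rcases zmod_two_cases d with rfl | rfl <;>
    simp [one_add_one_zmod_two]

end Amplitudes

section Circuit

/-! ### The action of the circuit -/

variable {n : ℕ}

lemma setPair_setPair (d e : Fin n) (w : Fin n → ZMod 2) (p q : ZMod 2 × ZMod 2) :
    setPair d e (setPair d e w p) q = setPair d e w q := by
  funext i
  by_cases he : i = e
  · subst he; simp
  by_cases hd : i = d
  · subst hd; simp [setPair_fst he]
  simp [setPair_of_ne, hd, he]

/-- The map `h` on the labels of the qubits `d` and `e`. -/
def gateMap (d e : Fin n) (h : ZMod 2 × ZMod 2 → ZMod 2 × ZMod 2) (t : Fin n → ZMod 2) :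
    Fin n → ZMod 2 :=
  setPair d e t (h (t d, t e))

/-- If `B` merges the amplitudes of the labels with equal image under `h`, then so does the
controlled gate on two of the qubits. -/
lemma onQubits_merge {d e : Fin n} (hde : d ≠ e) {h : ZMod 2 × ZMod 2 → ZMod 2 × ZMod 2}
    {B : ℝ → ℝ → Matrix (ZMod 2 × ZMod 2) (ZMod 2 × ZMod 2) ℂ}
    {κ : ℝ → ℝ → ZMod 2 × ZMod 2 → ℝ} {α β ra rb : (Fin n → ZMod 2) → ℝ}
    (hα : IgnoresPair d e α) (hβ : IgnoresPair d e β)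
    (hra : IgnoresPair d e ra) (hrb : IgnoresPair d e rb)
    (hB : ∀ t q s, (∑ p, B (α t) (β t) q p *
        if h p = s then ((amp (α t) p.1 * amp (β t) p.2 : ℝ) : ℂ) else 0) =
      if q = s then ((κ (α t) (β t) s : ℝ) : ℂ) else 0) (s : Fin n → ZMod 2) :
    onQubits d e (fun t => B (α t) (β t)) *ᵥ (fun t => if gateMap d e h t = s then
      (((ra t * amp (α t) (t d)) * (rb t * amp (β t) (t e)) : ℝ) : ℂ) else 0) =
    ((ra s * rb s * κ (α s) (β s) (s d, s e) : ℝ) : ℂ) • Pi.single s 1 := by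
  ext z
  rw [onQubits_mulVec hde]
  have hz : ∀ p, ∀ i, i ≠ d → i ≠ e → setPair d e z p i = z i :=
    fun p i => setPair_of_ne z p
  have e1 : ∀ p, α (setPair d e z p) = α z := fun p => hα _ _ (hz p)
  have e2 : ∀ p, β (setPair d e z p) = β z := fun p => hβ _ _ (hz p)
  have e3 : ∀ p, ra (setPair d e z p) = ra z := fun p => hra _ _ (hz p)
  have e4 : ∀ p, rb (setPair d e z p) = rb z := fun p => hrb _ _ (hz p)
  have e5 : ∀ p, gateMap d e h (setPair d e z p) = s ↔
      (∀ i, i ≠ d → i ≠ e → s i = z i) ∧ h p = (s d, s e) := by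
    intro p
    rw [gateMap, setPair_setPair, eq_comm, eq_setPair_iff hde, setPair_fst hde, setPair_snd]
    exact and_congr_right fun _ => eq_comm
  simp only [e1, e2, e3, e4, e5, setPair_fst hde, setPair_snd, Pi.smul_apply, smul_eq_mul]
  by_cases hs : ∀ i, i ≠ d → i ≠ e → s i = z i
  · simp only [eq_true hs, true_and]
    have := hB z (z d, z e) (s d, s e)
    -- The scales `ra` and `rb` do not read the two qubits and come out of the sum, which leaves the
    -- two-qubit identity `hB`.
    have hsum : ∀ p, B (α z) (β z) (z d, z e) p * (if h p = (s d, s e) then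
        (((ra z * amp (α z) p.1) * (rb z * amp (β z) p.2) : ℝ) : ℂ) else 0) =
        ((ra z * rb z : ℝ) : ℂ) * (B (α z) (β z) (z d, z e) p *
          if h p = (s d, s e) then ((amp (α z) p.1 * amp (β z) p.2 : ℝ) : ℂ) else 0) := by
      intro p
      split_ifs
      · push_cast; ring
      · simp
    simp only [hsum]
    rw [← Finset.mul_sum, this, hα s z hs, hβ s z hs, hra s z hs, hrb s z hs, Pi.single_apply]
    have : z = s ↔ (z d, z e) = (s d, s e) := by
      refine ⟨fun h => h ▸ rfl, fun h => ?_⟩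
      rw [(eq_setPair_iff hde z s _).2 ⟨fun i hd he => (hs i hd he).symm, h⟩, setPair_self hde]
    simp only [this]
    split_ifs
    · push_cast; ring
    · simp
  · have : z ≠ s := by
      rintro rfl; exact hs fun _ _ _ => rfl
    simp [hs, this]

namespace MPG

/-- The wires of the channel nodes of a tree. -/
def leaves : MPG n → Multiset (Fin n)
  | .leaf j => {j}
  | .eq a b => a.leaves + b.leaves
  | .check a b => a.leaves + b.leaves

lemma dataWire_mem_leaves (T : MPG n) : T.dataWire ∈ T.leaves := by
  induction T with
  | leaf j => simp [leaves, dataWire]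
  | eq a b iha ihb => simp [leaves, dataWire, iha]
  | check a b iha ihb => simp [leaves, dataWire, iha]

/-- The label to which the circuit of a tree merges the label `z`. -/
def syndrome : MPG n → (Fin n → ZMod 2) → (Fin n → ZMod 2)
  | .leaf _, z => z
  | .eq a b, z => gateMap a.dataWire b.dataWire eqMap (a.syndrome (b.syndrome z))
  | .check a b, z => gateMap a.dataWire b.dataWire checkMap (a.syndrome (b.syndrome z))

/-- The product of the channel amplitudes at the leaves. -/
def weight (θ : Fin n → ℝ) (T : MPG n) (z : Fin n → ZMod 2) : ℝ :=
  (T.leaves.map fun j => amp (θ j) (z j)).prod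

/-- The norm of the data qubit that belongs to the ancilla values `s`. -/
def scale (θ : Fin n → ℝ) : MPG n → (Fin n → ZMod 2) → ℝ
  | .leaf _, _ => 1
  | .eq a b, s => a.scale θ s * b.scale θ s * if s b.dataWire = 0 then 1 else 0
  | .check a b, s => a.scale θ s * b.scale θ s *
      Real.sqrt ((1 + (-1) ^ (s b.dataWire).val *
        (Real.cos (a.angle θ s) * Real.cos (b.angle θ s))) / 2)

/-- The amplitude of the label `s` after the circuit. -/
def outAmp (θ : Fin n → ℝ) (T : MPG n) (s : Fin n → ZMod 2) : ℝ :=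
  T.scale θ s * amp (T.angle θ s) (s T.dataWire)

lemma gateMap_of_ne {d e i : Fin n} (hd : i ≠ d) (he : i ≠ e) (h) (t : Fin n → ZMod 2) :
    gateMap d e h t i = t i := setPair_of_ne _ _ hd he

lemma syndrome_of_notMem (T : MPG n) (z : Fin n → ZMod 2) {i : Fin n} (hi : i ∉ T.leaves) :
    T.syndrome z i = z i := by
  induction T generalizing z with
  | leaf j => rfl
  | eq a b iha ihb | check a b iha ihb =>
    simp only [leaves, Multiset.mem_add, not_or] at hi
    rw [syndrome, gateMap_of_ne, iha _ hi.1, ihb _ hi.2]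
    · rintro rfl; exact hi.1 (dataWire_mem_leaves _)
    · rintro rfl; exact hi.2 (dataWire_mem_leaves _)

lemma dataWire_ne {a b : MPG n} (h : Disjoint a.leaves b.leaves) : a.dataWire ≠ b.dataWire :=
  fun h' => Multiset.disjoint_left.1 h a.dataWire_mem_leaves (h' ▸ b.dataWire_mem_leaves)

lemma agree_left {a b : MPG n} {s s' : Fin n → ZMod 2}
    (hs : ∀ i ∈ a.leaves + b.leaves, i ≠ a.dataWire → s i = s' i) :
    ∀ i ∈ a.leaves, i ≠ a.dataWire → s i = s' i :=
  fun i hi hd => hs i (Multiset.mem_add.2 (Or.inl hi)) hd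

lemma agree_right {a b : MPG n} (h : Disjoint a.leaves b.leaves) {s s' : Fin n → ZMod 2}
    (hs : ∀ i ∈ a.leaves + b.leaves, i ≠ a.dataWire → s i = s' i) :
    ∀ i ∈ b.leaves, s i = s' i := by
  refine fun i hi => hs i (Multiset.mem_add.2 (Or.inr hi)) ?_
  rintro rfl
  exact Multiset.disjoint_left.1 h a.dataWire_mem_leaves hi

/-- Only ancilla wires of the tree are read, never its data wire. This is why the gate at a node is
controlled by qubits other than the two it acts on. -/
lemma angle_congr (θ : Fin n → ℝ) (T : MPG n) (hT : T.leaves.Nodup) {s s' : Fin n → ZMod 2}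
    (hs : ∀ i ∈ T.leaves, i ≠ T.dataWire → s i = s' i) : T.angle θ s = T.angle θ s' := by
  induction T with
  | leaf j => rfl
  | eq a b iha ihb =>
    obtain ⟨ha, hb, hd⟩ := Multiset.nodup_add.1 hT
    rw [angle, angle, iha ha (agree_left hs), ihb hb fun i hi _ => agree_right hd hs i hi]
  | check a b iha ihb =>
    obtain ⟨ha, hb, hd⟩ := Multiset.nodup_add.1 hT
    rw [angle, angle, iha ha (agree_left hs), ihb hb fun i hi _ => agree_right hd hs i hi,
      agree_right hd hs _ b.dataWire_mem_leaves]

lemma scale_congr (θ : Fin n → ℝ) (T : MPG n) (hT : T.leaves.Nodup) {s s' : Fin n → ZMod 2}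
    (hs : ∀ i ∈ T.leaves, i ≠ T.dataWire → s i = s' i) : T.scale θ s = T.scale θ s' := by
  induction T with
  | leaf j => rfl
  | eq a b iha ihb =>
    obtain ⟨ha, hb, hd⟩ := Multiset.nodup_add.1 hT
    rw [scale, scale, iha ha (agree_left hs), ihb hb fun i hi _ => agree_right hd hs i hi,
      agree_right hd hs _ b.dataWire_mem_leaves]
  | check a b iha ihb =>
    obtain ⟨ha, hb, hd⟩ := Multiset.nodup_add.1 hT
    rw [scale, scale, iha ha (agree_left hs), ihb hb fun i hi _ => agree_right hd hs i hi,
      angle_congr θ a ha (agree_left hs),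
      angle_congr θ b hb fun i hi _ => agree_right hd hs i hi,
      agree_right hd hs _ b.dataWire_mem_leaves]

lemma outAmp_congr (θ : Fin n → ℝ) (T : MPG n) (hT : T.leaves.Nodup) {s s' : Fin n → ZMod 2}
    (hs : ∀ i ∈ T.leaves, s i = s' i) : T.outAmp θ s = T.outAmp θ s' := by
  rw [outAmp, outAmp, scale_congr θ T hT fun i hi _ => hs i hi,
    angle_congr θ T hT fun i hi _ => hs i hi, hs _ T.dataWire_mem_leaves]

lemma weight_congr (θ : Fin n → ℝ) (T : MPG n) {s s' : Fin n → ZMod 2}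
    (hs : ∀ i ∈ T.leaves, s i = s' i) : T.weight θ s = T.weight θ s' := by
  rw [weight, weight, Multiset.map_congr rfl]
  exact fun i hi => by rw [hs i hi]

lemma agree_off_pair_left {a b : MPG n} (h : Disjoint a.leaves b.leaves) {z w : Fin n → ZMod 2}
    (hs : ∀ i, i ≠ a.dataWire → i ≠ b.dataWire → z i = w i) :
    ∀ i ∈ a.leaves, i ≠ a.dataWire → z i = w i := by
  refine fun i hi hd => hs i hd ?_
  rintro rfl
  exact Multiset.disjoint_left.1 h hi b.dataWire_mem_leaves

lemma ignoresPair_left {α : Type*} {a b : MPG n} (h : Disjoint a.leaves b.leaves)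
    {f : (Fin n → ZMod 2) → α}
    (hf : ∀ z w, (∀ i ∈ a.leaves, i ≠ a.dataWire → z i = w i) → f z = f w) :
    IgnoresPair a.dataWire b.dataWire f :=
  fun z w hs => hf z w (agree_off_pair_left h hs)

lemma ignoresPair_right {α : Type*} {a b : MPG n} (h : Disjoint a.leaves b.leaves)
    {f : (Fin n → ZMod 2) → α}
    (hf : ∀ z w, (∀ i ∈ b.leaves, i ≠ b.dataWire → z i = w i) → f z = f w) :
    IgnoresPair a.dataWire b.dataWire f :=
  fun z w hs => hf z w (agree_off_pair_left h.symm fun i h1 h2 => hs i h2 h1)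

lemma angle_mem (θ : Fin n → ℝ) (hθ : ∀ j, θ j ∈ Set.Ioo 0 Real.pi) (T : MPG n)
    (s : Fin n → ZMod 2) : T.angle θ s ∈ Set.Ioo 0 Real.pi := by
  induction T with
  | leaf j => exact hθ j
  | eq a b iha ihb => exact eqAngle_mem iha ihb
  | check a b iha ihb => exact checkAngle_mem iha ihb _

lemma outAmp_nonneg (θ : Fin n → ℝ) (hθ : ∀ j, θ j ∈ Set.Ioo 0 Real.pi) (T : MPG n)
    (s : Fin n → ZMod 2) : 0 ≤ T.outAmp θ s := by
  refine mul_nonneg ?_ (amp_pos (angle_mem θ hθ T s) _).le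
  induction T with
  | leaf j => exact zero_le_one
  | eq a b iha ihb => exact mul_nonneg (mul_nonneg iha ihb) (by split_ifs <;> norm_num)
  | check a b iha ihb => exact mul_nonneg (mul_nonneg iha ihb) (Real.sqrt_nonneg _)

/-- The circuit of a tree without repeated wires is unitary. -/
theorem circuit_mem_unitaryGroup (θ : Fin n → ℝ) (hθ : ∀ j, θ j ∈ Set.Ioo 0 Real.pi) (T : MPG n)
    (hT : T.leaves.Nodup) : T.circuit θ ∈ unitaryGroup (Fin n → ZMod 2) ℂ := by
  induction T with
  | leaf j => exact one_mem _
  | eq a b iha ihb =>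
    obtain ⟨ha, hb, hd⟩ := Multiset.nodup_add.1 hT
    refine mul_mem (onQubits_mem_unitaryGroup (dataWire_ne hd) _ ?_ fun s =>
      eqUnitary_mem_unitaryGroup (angle_mem θ hθ a s) (angle_mem θ hθ b s))
      (mul_mem (iha ha) (ihb hb))
    intro z w hs
    simp only
    rw [ignoresPair_left hd (fun z w => angle_congr θ a ha) z w hs,
      ignoresPair_right hd (fun z w => angle_congr θ b hb) z w hs]
  | check a b iha ihb =>
    obtain ⟨ha, hb, hd⟩ := Multiset.nodup_add.1 hT
    exact mul_mem (onQubits_mem_unitaryGroup (dataWire_ne hd) _ (fun _ _ _ => rfl) fun s =>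
      cnot_mem_unitaryGroup) (mul_mem (iha ha) (ihb hb))

/-- The part of the product of the channel amplitudes with syndrome `s`. -/
def syndromeVec (θ : Fin n → ℝ) (T : MPG n) (s : Fin n → ZMod 2) : (Fin n → ZMod 2) → ℂ :=
  fun z => if T.syndrome z = s then (T.weight θ z : ℂ) else 0

/-- The two subtrees use disjoint wires, so each circuit and each syndrome map leaves the data of
the other subtree alone. -/
lemma circuit_pair_mulVec (θ : Fin n → ℝ) {a b : MPG n} (hb : b.leaves.Nodup)
    (hd : Disjoint a.leaves b.leaves)
    (iha : ∀ s, a.circuit θ *ᵥ a.syndromeVec θ s = (a.outAmp θ s : ℂ) • Pi.single s 1)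
    (ihb : ∀ s, b.circuit θ *ᵥ b.syndromeVec θ s = (b.outAmp θ s : ℂ) • Pi.single s 1)
    (t : Fin n → ZMod 2) :
    (a.circuit θ * b.circuit θ) *ᵥ (fun z => if a.syndrome (b.syndrome z) = t then
      ((a.weight θ z * b.weight θ z : ℝ) : ℂ) else 0) =
      ((a.outAmp θ t * b.outAmp θ t : ℝ) : ℂ) • Pi.single t 1 := by
  -- The labels are sorted by u = `b.syndrome z`; passing from z to u does not change the weight of
  -- `a`.
  have h1 : (fun z => if a.syndrome (b.syndrome z) = t then
      ((a.weight θ z * b.weight θ z : ℝ) : ℂ) else 0) =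
      ∑ u, a.syndromeVec θ t u • b.syndromeVec θ u := by
    funext z
    simp only [Finset.sum_apply, Pi.smul_apply, smul_eq_mul, syndromeVec, mul_ite, mul_zero,
      Finset.sum_ite_eq, Finset.mem_univ, if_true, ite_mul, zero_mul]
    have : a.weight θ (b.syndrome z) = a.weight θ z :=
      weight_congr θ a fun i hi => syndrome_of_notMem b z (Multiset.disjoint_left.1 hd hi)
    rw [this]
    push_cast
    rfl
  -- On a fibre of `a.syndrome` the wires of `b` are fixed, so `b.outAmp` is a constant factor
  -- there.
  have h2 : ∑ u, a.syndromeVec θ t u • ((b.outAmp θ u : ℂ) • (Pi.single u 1 : _ → ℂ)) =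
      (b.outAmp θ t : ℂ) • a.syndromeVec θ t := by
    funext z
    simp only [Finset.sum_apply, Pi.smul_apply, smul_eq_mul, syndromeVec, Pi.single_apply, mul_ite,
      mul_one, mul_zero, Finset.sum_ite_eq, Finset.mem_univ, if_true, ite_mul, zero_mul]
    by_cases h : a.syndrome z = t
    · have : b.outAmp θ z = b.outAmp θ t := by
        refine outAmp_congr θ b hb fun i hi => ?_
        rw [← h, syndrome_of_notMem a z (Multiset.disjoint_right.1 hd hi)]
      rw [if_pos h, if_pos h, this, mul_comm]
    · rw [if_neg h, if_neg h]
  rw [h1, ← mulVec_mulVec, mulVec_sum]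
  simp only [mulVec_smul, ihb]
  rw [h2, mulVec_smul, iha, smul_smul]
  push_cast
  rw [mul_comm]

lemma weight_eq (θ : Fin n → ℝ) (a b : MPG n) (z : Fin n → ZMod 2) :
    (MPG.eq a b).weight θ z = a.weight θ z * b.weight θ z := by
  rw [weight, leaves, Multiset.map_add, Multiset.prod_add, weight, weight]

lemma weight_check (θ : Fin n → ℝ) (a b : MPG n) (z : Fin n → ZMod 2) :
    (MPG.check a b).weight θ z = a.weight θ z * b.weight θ z := by
  rw [weight, leaves, Multiset.map_add, Multiset.prod_add, weight, weight]

/-- A fibre of the full syndrome is the union of the pair fibres over all t with the given image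
under the gate map; `circuit_pair_mulVec` is summed over these t. -/
lemma circuit_node_mulVec (θ : Fin n → ℝ) {a b : MPG n}
    (hb : b.leaves.Nodup) (hd : Disjoint a.leaves b.leaves)
    (iha : ∀ s, a.circuit θ *ᵥ a.syndromeVec θ s = (a.outAmp θ s : ℂ) • Pi.single s 1)
    (ihb : ∀ s, b.circuit θ *ᵥ b.syndromeVec θ s = (b.outAmp θ s : ℂ) • Pi.single s 1)
    (h : ZMod 2 × ZMod 2 → ZMod 2 × ZMod 2) (s : Fin n → ZMod 2) :
    (a.circuit θ * b.circuit θ) *ᵥ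
      (fun z => if gateMap a.dataWire b.dataWire h (a.syndrome (b.syndrome z)) = s then
        ((a.weight θ z * b.weight θ z : ℝ) : ℂ) else 0) =
      fun t => if gateMap a.dataWire b.dataWire h t = s then
        ((a.outAmp θ t * b.outAmp θ t : ℝ) : ℂ) else 0 := by
  have h1 : (fun z => if gateMap a.dataWire b.dataWire h (a.syndrome (b.syndrome z)) = s then
        ((a.weight θ z * b.weight θ z : ℝ) : ℂ) else 0) =
      ∑ t, (if gateMap a.dataWire b.dataWire h t = s then (1 : ℂ) else 0) •
        fun z => if a.syndrome (b.syndrome z) = t then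
          ((a.weight θ z * b.weight θ z : ℝ) : ℂ) else 0 := by
    funext z
    simp only [Finset.sum_apply, Pi.smul_apply, smul_eq_mul, mul_ite, mul_zero,
      Finset.sum_ite_eq, Finset.mem_univ, if_true, ite_mul, zero_mul, one_mul]
  rw [h1, mulVec_sum]
  simp only [mulVec_smul, circuit_pair_mulVec θ hb hd iha ihb]
  funext z
  simp only [Finset.sum_apply, Pi.smul_apply, smul_eq_mul, Pi.single_apply, mul_ite, mul_one,
    mul_zero, Finset.sum_ite_eq, Finset.mem_univ, if_true, ite_mul, zero_mul, one_mul]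

/-- The circuit maps the components with fixed syndrome to multiples of basis states. -/
theorem circuit_mulVec_syndromeVec (θ : Fin n → ℝ) (hθ : ∀ j, θ j ∈ Set.Ioo 0 Real.pi) (T : MPG n)
    (hT : T.leaves.Nodup) (s : Fin n → ZMod 2) :
    T.circuit θ *ᵥ T.syndromeVec θ s = (T.outAmp θ s : ℂ) • Pi.single s 1 := by
  induction T generalizing s with
  | leaf j =>
    funext z
    by_cases h : z = s
    · simp [circuit, syndromeVec, syndrome, outAmp, weight, leaves, scale, angle, dataWire, h]
    · simp [circuit, syndromeVec, syndrome, h]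
  | eq a b iha ihb =>
    obtain ⟨ha, hb, hd⟩ := Multiset.nodup_add.1 hT
    unfold syndromeVec
    simp only [circuit, syndrome, weight_eq]
    rw [← mulVec_mulVec, circuit_node_mulVec θ hb hd (iha ha) (ihb hb)]
    -- The amplitude is 0 at ancilla value 1 because `eqMap` only reaches ancilla value 0.
    refine (onQubits_merge (dataWire_ne hd) (B := eqUnitary)
      (κ := fun α β s => if s.2 = 0 then amp (eqAngle α β) s.1 else 0)
      (ignoresPair_left hd fun z w => angle_congr θ a ha)
      (ignoresPair_right hd fun z w => angle_congr θ b hb)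
      (ignoresPair_left hd fun z w => scale_congr θ a ha)
      (ignoresPair_right hd fun z w => scale_congr θ b hb)
      (fun t => eqUnitary_merge (angle_mem θ hθ a t) (angle_mem θ hθ b t)) s).trans ?_
    congr 2
    simp only [outAmp, scale, angle, dataWire]
    split_ifs <;> ring
  | check a b iha ihb =>
    obtain ⟨ha, hb, hd⟩ := Multiset.nodup_add.1 hT
    unfold syndromeVec
    simp only [circuit, syndrome, weight_check]
    rw [← mulVec_mulVec, circuit_node_mulVec θ hb hd (iha ha) (ihb hb)]
    refine (onQubits_merge (dataWire_ne hd) (B := fun _ _ => cnot)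
      (κ := fun α β s => Real.sqrt ((1 + (-1) ^ s.2.val * (Real.cos α * Real.cos β)) / 2) *
        amp (checkAngle s.2 α β) s.1)
      (ignoresPair_left hd fun z w => angle_congr θ a ha)
      (ignoresPair_right hd fun z w => angle_congr θ b hb)
      (ignoresPair_left hd fun z w => scale_congr θ a ha)
      (ignoresPair_right hd fun z w => scale_congr θ b hb)
      (fun t => cnot_merge (angle_mem θ hθ a t) (angle_mem θ hθ b t)) s).trans ?_
    congr 2
    simp only [outAmp, scale, angle, dataWire]
    ring

/-! ### The code of a tree -/

/-- The bit that a node passes on for the input `x`. -/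
def out : MPG n → (Fin n → ZMod 2) → ZMod 2
  | .leaf j, x => x j
  | .eq a _, x => a.out x
  | .check a b, x => a.out x + b.out x

/-- All equality nodes of the tree receive equal bits. -/
def Sat : MPG n → (Fin n → ZMod 2) → Prop
  | .leaf _, _ => True
  | .eq a b, x => a.Sat x ∧ b.Sat x ∧ a.out x = b.out x
  | .check a b, x => a.Sat x ∧ b.Sat x

/-- The transpose of `syndrome`. -/
def encode : MPG n → (Fin n → ZMod 2) → (Fin n → ZMod 2)
  | .leaf _, y => y
  | .eq a b, y => b.encode (a.encode (gateMap a.dataWire b.dataWire (fun p => (p.1, p.1)) y))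
  | .check a b, y =>
      b.encode (a.encode (gateMap a.dataWire b.dataWire (fun p => (p.1 + p.2, p.2)) y))

lemma encode_of_notMem (T : MPG n) (y : Fin n → ZMod 2) {i : Fin n} (hi : i ∉ T.leaves) :
    T.encode y i = y i := by
  induction T generalizing y with
  | leaf j => rfl
  | eq a b iha ihb | check a b iha ihb =>
    simp only [leaves, Multiset.mem_add, not_or] at hi
    rw [encode, ihb _ hi.2, iha _ hi.1, gateMap_of_ne]
    · rintro rfl; exact hi.1 (dataWire_mem_leaves _)
    · rintro rfl; exact hi.2 (dataWire_mem_leaves _)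

lemma dotProduct_eq_pair {d e : Fin n} (h : d ≠ e) (x z : Fin n → ZMod 2) :
    x ⬝ᵥ z = x d * z d + (x e * z e + ∑ i ∈ (Finset.univ.erase d).erase e, x i * z i) := by
  rw [dotProduct, Finset.add_sum_erase _ (fun i => x i * z i) (by simp [h.symm]),
    Finset.add_sum_erase _ (fun i => x i * z i) (by simp)]

/-- The hypothesis `hh` says that `h'` is the transpose of `h`; the coordinates other than `d` and
`e` contribute equally. -/
lemma dotProduct_gateMap {d e : Fin n} (hde : d ≠ e) {h h' : ZMod 2 × ZMod 2 → ZMod 2 × ZMod 2}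
    (hh : ∀ p q, p.1 * (h q).1 + p.2 * (h q).2 = (h' p).1 * q.1 + (h' p).2 * q.2)
    (y z : Fin n → ZMod 2) : y ⬝ᵥ gateMap d e h z = gateMap d e h' y ⬝ᵥ z := by
  rw [dotProduct_eq_pair hde, dotProduct_eq_pair hde, ← add_assoc, ← add_assoc]
  have := hh (y d, y e) (z d, z e)
  simp only [gateMap, setPair_fst hde, setPair_snd] at this ⊢
  rw [this]
  congr 1
  refine Finset.sum_congr rfl fun i hi => ?_
  simp only [Finset.mem_erase, Finset.mem_univ, and_true] at hi
  rw [setPair_of_ne _ _ hi.2 hi.1, setPair_of_ne _ _ hi.2 hi.1]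

lemma dotProduct_syndrome (T : MPG n) (hT : T.leaves.Nodup) (y z : Fin n → ZMod 2) :
    y ⬝ᵥ T.syndrome z = T.encode y ⬝ᵥ z := by
  induction T generalizing y z with
  | leaf j => rfl
  | eq a b iha ihb =>
    obtain ⟨ha, hb, hd⟩ := Multiset.nodup_add.1 hT
    rw [syndrome, encode, ← ihb hb, ← iha ha, dotProduct_gateMap (dataWire_ne hd)]
    intro p q
    simp only [eqMap]
    ring
  | check a b iha ihb =>
    obtain ⟨ha, hb, hd⟩ := Multiset.nodup_add.1 hT
    rw [syndrome, encode, ← ihb hb, ← iha ha, dotProduct_gateMap (dataWire_ne hd)]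
    intro p q
    simp only [checkMap]
    ring

lemma out_congr (T : MPG n) {x x' : Fin n → ZMod 2} (h : ∀ i ∈ T.leaves, x i = x' i) :
    T.out x = T.out x' := by
  induction T with
  | leaf j => exact h j (by simp [leaves])
  | eq a b iha ihb => exact iha fun i hi => h i (Multiset.mem_add.2 (Or.inl hi))
  | check a b iha ihb =>
    rw [out, out, iha fun i hi => h i (Multiset.mem_add.2 (Or.inl hi)),
      ihb fun i hi => h i (Multiset.mem_add.2 (Or.inr hi))]

lemma sat_congr (T : MPG n) {x x' : Fin n → ZMod 2} (h : ∀ i ∈ T.leaves, x i = x' i) :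
    T.Sat x ↔ T.Sat x' := by
  induction T with
  | leaf j => rfl
  | eq a b iha ihb =>
    have h1 : ∀ i ∈ a.leaves, x i = x' i := fun i hi => h i (Multiset.mem_add.2 (Or.inl hi))
    have h2 : ∀ i ∈ b.leaves, x i = x' i := fun i hi => h i (Multiset.mem_add.2 (Or.inr hi))
    rw [Sat, Sat, iha h1, ihb h2, out_congr a h1, out_congr b h2]
  | check a b iha ihb =>
    have h1 : ∀ i ∈ a.leaves, x i = x' i := fun i hi => h i (Multiset.mem_add.2 (Or.inl hi))
    have h2 : ∀ i ∈ b.leaves, x i = x' i := fun i hi => h i (Multiset.mem_add.2 (Or.inr hi))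
    rw [Sat, Sat, iha h1, ihb h2]

/-- Read from the root to the leaves, `encode` copies the required bit to both predecessors of an
equality node and splits it as (p₁ + p₂) + p₂ at a check node, where the ancilla p₂ is free. -/
lemma sat_encode_and_out (T : MPG n) (hT : T.leaves.Nodup) (y : Fin n → ZMod 2) :
    T.Sat (T.encode y) ∧ T.out (T.encode y) = y T.dataWire := by
  induction T generalizing y with
  | leaf j => exact ⟨trivial, rfl⟩
  | eq a b iha ihb | check a b iha ihb =>
    obtain ⟨ha, hb, hd⟩ := Multiset.nodup_add.1 hT
    have hne := dataWire_ne hd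
    simp only [encode, Sat, out, dataWire]
    generalize hy : gateMap a.dataWire b.dataWire _ y = y'
    obtain ⟨sb, ob⟩ := ihb hb (a.encode y')
    obtain ⟨sa, oa⟩ := iha ha y'
    have hab : ∀ i ∈ a.leaves, b.encode (a.encode y') i = a.encode y' i :=
      fun i hi => encode_of_notMem b _ (Multiset.disjoint_left.1 hd hi)
    rw [encode_of_notMem a _ (Multiset.disjoint_right.1 hd b.dataWire_mem_leaves)] at ob
    have hyd := congrFun hy a.dataWire
    have hye := congrFun hy b.dataWire
    rw [gateMap, setPair_fst hne] at hyd
    rw [gateMap, setPair_snd] at hye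
    rw [sat_congr a hab, out_congr a hab, ob, oa, ← hyd, ← hye]
    simp [sa, sb, add_assoc, CharTwo.add_self_eq_zero]

/-- The encoding can be undone node by node: the copy map fixes labels whose two bits agree, as
satisfaction demands, and the map at a check node is an involution. -/
lemma exists_encode_eq (T : MPG n) (hT : T.leaves.Nodup) (x : Fin n → ZMod 2) (hx : T.Sat x) :
    ∃ y, T.encode y = x := by
  induction T generalizing x with
  | leaf j => exact ⟨x, rfl⟩
  | eq a b iha ihb =>
    obtain ⟨ha, hb, hd⟩ := Multiset.nodup_add.1 hT
    have hne := dataWire_ne hd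
    obtain ⟨x', rfl⟩ := ihb hb x hx.2.1
    have hab : ∀ i ∈ a.leaves, b.encode x' i = x' i :=
      fun i hi => encode_of_notMem b _ (Multiset.disjoint_left.1 hd hi)
    obtain ⟨y, rfl⟩ := iha ha x' ((sat_congr a hab).1 hx.1)
    refine ⟨y, ?_⟩
    have h := hx.2.2
    rw [out_congr a hab, (sat_encode_and_out a ha y).2, (sat_encode_and_out b hb _).2,
      encode_of_notMem a _ (Multiset.disjoint_right.1 hd b.dataWire_mem_leaves)] at h
    have hy : gateMap a.dataWire b.dataWire (fun p => (p.1, p.1)) y = y :=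
      ((eq_setPair_iff hne _ _ _).2 ⟨fun _ _ _ => rfl, by rw [h]⟩).symm
    rw [encode, hy]
  | check a b iha ihb =>
    obtain ⟨ha, hb, hd⟩ := Multiset.nodup_add.1 hT
    have hne := dataWire_ne hd
    obtain ⟨x', rfl⟩ := ihb hb x hx.2
    have hab : ∀ i ∈ a.leaves, b.encode x' i = x' i :=
      fun i hi => encode_of_notMem b _ (Multiset.disjoint_left.1 hd hi)
    obtain ⟨y, rfl⟩ := iha ha x' ((sat_congr a hab).1 hx.1)
    refine ⟨gateMap a.dataWire b.dataWire (fun p => (p.1 + p.2, p.2)) y, ?_⟩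
    have hy : gateMap a.dataWire b.dataWire (fun p => (p.1 + p.2, p.2))
        (gateMap a.dataWire b.dataWire (fun p => (p.1 + p.2, p.2)) y) = y := by
      simp only [gateMap, setPair_fst hne, setPair_snd, setPair_setPair, add_assoc,
        CharTwo.add_self_eq_zero, add_zero, setPair_self hne]
    rw [encode, hy]

end MPG

end Circuit

section MessagePassing

/-! ### Message-passing graphs of trees -/

/-! ### Vertices behind an edge of an acyclic graph -/

section Behind

variable {V : Type*} {G : SimpleGraph V}

/-- `u` can be reached from `v` by a path that avoids `p`. -/
def Behind (G : SimpleGraph V) (p v u : V) : Prop :=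
  ∃ q : G.Walk v u, q.IsPath ∧ p ∉ q.support

lemma Behind.refl {p v : V} (h : p ≠ v) : Behind G p v v :=
  ⟨.nil, by simp, by simpa using h⟩

lemma not_behind_self (v w : V) : ¬ Behind G v w v :=
  fun ⟨q, _, hq⟩ => hq q.end_mem_support

lemma Behind.step (hG : G.IsAcyclic) {p v w u : V} (hp : G.Adj p v) (hw : G.Adj v w) (hne : w ≠ p)
    (h : Behind G v w u) : Behind G p v u := by
  classical
  obtain ⟨q, hq, hv⟩ := h
  refine ⟨.cons hw q, hq.cons hv, ?_⟩
  rw [SimpleGraph.Walk.support_cons, List.mem_cons, not_or]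
  refine ⟨hp.ne, fun hpq => ?_⟩
  -- If p lay on q, there would be two paths from w to p: this one avoids v, the next passes through
  -- v.
  let q₁ : G.Path w p := ⟨q.takeUntil p hpq, hq.takeUntil hpq⟩
  let q₂ : G.Path w p := ⟨.cons hw.symm (.cons hp.symm .nil), by
    simp [SimpleGraph.Walk.cons_isPath_iff, hw.ne', hp.ne', hne]⟩
  have h : q₁ = q₂ := (hG.subsingleton_path w p).elim _ _
  have hv₁ : v ∉ q₁.1.support := fun hmem => hv (q.support_takeUntil_subset_support hpq hmem)
  rw [h] at hv₁
  simp [q₂] at hv₁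

lemma Behind.cases {p v u : V} (h : Behind G p v u) :
    u = v ∨ ∃ w, G.Adj v w ∧ w ≠ p ∧ Behind G v w u := by
  obtain ⟨q, hq, hp⟩ := h
  cases q with
  | nil => exact Or.inl rfl
  | @cons _ w _ hw q =>
    rw [SimpleGraph.Walk.cons_isPath_iff] at hq
    refine Or.inr ⟨w, hw, ?_, q, hq.1, hq.2⟩
    rintro rfl
    exact hp (by simp)

lemma Behind.unique (hG : G.IsAcyclic) {v w w' u : V} (hw : G.Adj v w) (hw' : G.Adj v w')
    (h : Behind G v w u) (h' : Behind G v w' u) : w = w' := by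
  obtain ⟨q, hq, hv⟩ := h
  obtain ⟨q', hq', hv'⟩ := h'
  have := congrArg Subtype.val ((hG.subsingleton_path v u).elim
    ⟨.cons hw q, hq.cons hv⟩ ⟨.cons hw' q', hq'.cons hv'⟩)
  simp only [SimpleGraph.Walk.cons.injEq] at this
  exact this.1

lemma exists_behind (hG : G.Connected) {v u : V} (h : u ≠ v) : ∃ w, G.Adj v w ∧ Behind G v w u := by
  obtain ⟨q, hq⟩ := hG.exists_isPath v u
  cases q with
  | nil => exact absurd rfl h
  | @cons _ w _ hw q =>
    rw [SimpleGraph.Walk.cons_isPath_iff] at hq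
    exact ⟨w, hw, q, hq.1, hq.2⟩

lemma behind_iff (hG : G.IsAcyclic) {p v : V} (hp : G.Adj p v) (u : V) :
    Behind G p v u ↔ u = v ∨ ∃ w, G.Adj v w ∧ w ≠ p ∧ Behind G v w u := by
  refine ⟨Behind.cases, ?_⟩
  rintro (rfl | ⟨w, hw, hne, h⟩)
  · exact Behind.refl hp.ne
  · exact h.step hG hp hw hne

/-- The vertex v is lost when moving on to w. This count is the measure for the recursive
construction of branches. -/
lemma ncard_behind_lt [Finite V] (hG : G.IsAcyclic) {p v w : V} (hp : G.Adj p v) (hw : G.Adj v w)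
    (hne : w ≠ p) : {u | Behind G v w u}.ncard < {u | Behind G p v u}.ncard := by
  refine Set.ncard_lt_ncard ?_ (Set.toFinite _)
  refine ⟨fun u hu => Behind.step hG hp hw hne hu, fun h => not_behind_self (G := G) v w ?_⟩
  exact h (Behind.refl hp.ne)

end Behind

variable {m n : ℕ}

/-! ### Leaves and satisfaction of branches -/

lemma Combines.leaves_eq {s : Multiset (MPG n)} {T : MPG n} :
    Combines MPG.eq s T → T.leaves = s.bind MPG.leaves := by
  intro h
  induction h with
  | single T => simp
  | join _ _ ih1 ih2 => rw [MPG.leaves, Multiset.add_bind, ih1, ih2]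

lemma Combines.leaves_check {s : Multiset (MPG n)} {T : MPG n} :
    Combines MPG.check s T → T.leaves = s.bind MPG.leaves := by
  intro h
  induction h with
  | single T => simp
  | join _ _ ih1 ih2 => rw [MPG.leaves, Multiset.add_bind, ih1, ih2]

/-- Any bracketing of equality nodes demands that all parts pass on one common bit. The first
component holds because the output is that of the leftmost part; it pins down the common bit. -/
lemma Combines.sat_eq {s : Multiset (MPG n)} {T : MPG n} (h : Combines MPG.eq s T)
    (x : Fin n → ZMod 2) : (∃ A ∈ s, A.out x = T.out x) ∧
      (T.Sat x ↔ ∀ A ∈ s, A.Sat x ∧ A.out x = T.out x) := by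
  induction h with
  | single T => simp
  | @join s t A B _ _ ih1 ih2 =>
    obtain ⟨⟨A', hA', eA⟩, hA⟩ := ih1
    obtain ⟨⟨B', hB', eB⟩, hB⟩ := ih2
    refine ⟨⟨A', Multiset.mem_add.2 (Or.inl hA'), eA⟩, ?_⟩
    simp only [MPG.Sat, MPG.out, hA, hB, Multiset.mem_add]
    constructor
    · rintro ⟨h1, h2, h3⟩ D (hD | hD)
      · exact h1 D hD
      · rw [h3]; exact h2 D hD
    · intro h
      have h3 : A.out x = B.out x := by rw [← eB, (h B' (Or.inr hB')).2]
      exact ⟨fun D hD => h D (Or.inl hD), fun D hD => h3 ▸ h D (Or.inr hD), h3⟩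

lemma Combines.sat_check {s : Multiset (MPG n)} {T : MPG n} (h : Combines MPG.check s T)
    (x : Fin n → ZMod 2) : T.out x = (s.map fun A => A.out x).sum ∧
      (T.Sat x ↔ ∀ A ∈ s, A.Sat x) := by
  induction h with
  | single T => simp
  | join _ _ ih1 ih2 =>
    refine ⟨by rw [MPG.out, Multiset.map_add, Multiset.sum_add, ih1.1, ih2.1], ?_⟩
    simp only [MPG.Sat, ih1.2, ih2.2, Multiset.mem_add]
    grind

lemma exists_combines (op : MPG n → MPG n → MPG n) (s : Multiset (MPG n)) (hs : s ≠ 0) :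
    ∃ T, Combines op s T := by
  induction s using Multiset.induction with
  | empty => exact absurd rfl hs
  | cons A s ih =>
    by_cases h : s = 0
    · exact ⟨A, h ▸ Combines.single A⟩
    · obtain ⟨T, hT⟩ := ih h
      exact ⟨op A T, (Combines.single A).join hT⟩

lemma nodup_bind_finset {ι α : Type*} (S : Finset ι) (g : ι → Multiset α)
    (h1 : ∀ c ∈ S, (g c).Nodup) (h2 : ∀ c ∈ S, ∀ c' ∈ S, ∀ a, a ∈ g c → a ∈ g c' → c = c') :
    (S.val.bind g).Nodup := by
  rw [Multiset.nodup_bind]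
  refine ⟨h1, Multiset.Nodup.pairwise (fun c hc c' hc' hne => ?_) S.nodup⟩
  rw [Function.onFun, Multiset.disjoint_left]
  exact fun {a} ha ha' => hne (h2 c hc c' hc' a ha ha')

/-- The leaves of a branch are the bits behind it, without repetition. -/
lemma Branch.leaves_spec {H : Matrix (Fin m) (Fin n) (ZMod 2)} (hG : (tannerGraph H).IsAcyclic)
    {p v : Fin n ⊕ Fin m} {T : MPG n} (h : Branch H p v T) (hp : (tannerGraph H).Adj p v) :
    T.leaves.Nodup ∧ ∀ j, j ∈ T.leaves ↔ Behind (tannerGraph H) p v (.inl j) := by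
  induction h with
  | bit c j f T hf hT ih =>
    rw [hT.leaves_eq, Multiset.cons_bind, Multiset.bind_map]
    have ih' : ∀ c', H c' j ≠ 0 → c' ≠ c → (f c').leaves.Nodup ∧ ∀ i, i ∈ (f c').leaves ↔
        Behind (tannerGraph H) (.inl j) (.inr c') (.inl i) := fun c' h1 h2 => ih c' h1 h2 h1
    constructor
    · rw [MPG.leaves, Multiset.singleton_add, Multiset.nodup_cons]
      constructor
      · simp only [Multiset.mem_bind, Finset.mem_val, Finset.mem_filter, Finset.mem_univ, true_and]
        rintro ⟨c', ⟨h1, h2⟩, h3⟩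
        exact not_behind_self _ _ (((ih' c' h1 h2).2 j).1 h3)
      · refine nodup_bind_finset _ _ ?_ ?_
        · simp only [Finset.mem_filter, Finset.mem_univ, true_and]
          exact fun c' hc' => (ih' c' hc'.1 hc'.2).1
        · simp only [Finset.mem_filter, Finset.mem_univ, true_and]
          intro c' h1 c'' h2 i h3 h4
          rw [(ih' _ h1.1 h1.2).2] at h3
          rw [(ih' _ h2.1 h2.2).2] at h4
          exact Sum.inr_injective (h3.unique hG (v := .inl j) h1.1 h2.1 h4)
    · intro i
      rw [behind_iff hG hp]
      simp only [MPG.leaves, Multiset.singleton_add, Multiset.mem_cons, Multiset.mem_bind,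
        Finset.mem_val, Finset.mem_filter, Finset.mem_univ, true_and, Sum.inl.injEq]
      refine or_congr_right ⟨?_, ?_⟩
      · rintro ⟨c', ⟨h1, h2⟩, h3⟩
        exact ⟨.inr c', h1, by simpa using h2, ((ih' c' h1 h2).2 i).1 h3⟩
      · rintro ⟨w | c', h1, h2, h3⟩
        · exact h1.elim
        · have h2' : c' ≠ c := by simpa using h2
          exact ⟨c', ⟨h1, h2'⟩, ((ih' c' h1 h2').2 i).2 h3⟩
  | check j c f T hf hT ih =>
    rw [hT.leaves_check, Multiset.bind_map]
    have ih' : ∀ j', H c j' ≠ 0 → j' ≠ j → (f j').leaves.Nodup ∧ ∀ i, i ∈ (f j').leaves ↔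
        Behind (tannerGraph H) (.inr c) (.inl j') (.inl i) := fun c' h1 h2 => ih c' h1 h2 h1
    constructor
    · refine nodup_bind_finset _ _ ?_ ?_
      · simp only [Finset.mem_filter, Finset.mem_univ, true_and]
        exact fun c' hc' => (ih' c' hc'.1 hc'.2).1
      · simp only [Finset.mem_filter, Finset.mem_univ, true_and]
        intro c' h1 c'' h2 i h3 h4
        rw [(ih' _ h1.1 h1.2).2] at h3
        rw [(ih' _ h2.1 h2.2).2] at h4
        exact Sum.inl_injective (h3.unique hG (v := .inr c) h1.1 h2.1 h4)
    · intro i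
      rw [behind_iff hG hp]
      simp only [Multiset.mem_bind, Finset.mem_val, Finset.mem_filter, Finset.mem_univ, true_and,
        reduceCtorEq, false_or]
      constructor
      · rintro ⟨c', ⟨h1, h2⟩, h3⟩
        exact ⟨.inl c', h1, by simpa using h2, ((ih' c' h1 h2).2 i).1 h3⟩
      · rintro ⟨c' | w, h1, h2, h3⟩
        · have h2' : c' ≠ j := by simpa using h2
          exact ⟨c', ⟨h1, h2'⟩, ((ih' c' h1 h2').2 i).2 h3⟩
        · exact h1.elim

lemma mulVec_eq_add_sum (H : Matrix (Fin m) (Fin n) (ZMod 2)) (x : Fin n → ZMod 2) {c : Fin m}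
    {j : Fin n} (h : H c j ≠ 0) :
    (H *ᵥ x) c = x j + ∑ i ∈ Finset.univ.filter (fun i => H c i ≠ 0 ∧ i ≠ j), x i := by
  have h1 : ∀ i, H c i * x i = if H c i ≠ 0 then x i else 0 := by
    intro i
    rcases zmod_two_cases (H c i) with h | h <;> simp [h]
  rw [mulVec, dotProduct]
  simp only [h1]
  rw [← Finset.sum_filter, ← Finset.add_sum_erase (a := j) _ _ (by simp [h])]
  congr 1
  refine Finset.sum_congr ?_ fun _ _ => rfl
  ext i
  simp [and_comm]

/-- What a branch that starts at a given edge says about the checks behind this edge. -/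
def BranchSpec (H : Matrix (Fin m) (Fin n) (ZMod 2)) (x : Fin n → ZMod 2) (T : MPG n) :
    Fin n ⊕ Fin m → Fin n ⊕ Fin m → Prop
  | .inr c, .inl j =>
      (T.Sat x → T.out x = x j ∧
        ∀ c', Behind (tannerGraph H) (.inr c) (.inl j) (.inr c') → (H *ᵥ x) c' = 0) ∧
      (H *ᵥ x = 0 → T.Sat x)
  | .inl j, .inr c =>
      (T.Sat x → T.out x = x j →
        ∀ c', Behind (tannerGraph H) (.inl j) (.inr c) (.inr c') → (H *ᵥ x) c' = 0) ∧
      (H *ᵥ x = 0 → T.Sat x ∧ T.out x = x j)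
  | _, _ => True

/-- The two directions differ: a branch at a bit node contains the leaf of that bit and so outputs x
j by itself, whereas a branch at a check node outputs the sum of its other bits, which equals x j
exactly if the check holds. -/
lemma Branch.sat_spec {H : Matrix (Fin m) (Fin n) (ZMod 2)}
    {p v : Fin n ⊕ Fin m} {T : MPG n} (h : Branch H p v T) (hp : (tannerGraph H).Adj p v)
    (x : Fin n → ZMod 2) : BranchSpec H x T p v := by
  induction h with
  | bit c j f T hf hT ih =>
    have ih' : ∀ c', H c' j ≠ 0 → c' ≠ c → BranchSpec H x (f c') (.inl j) (.inr c') :=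
      fun c' h1 h2 => ih c' h1 h2 h1
    simp only [BranchSpec] at ih' ⊢
    have hS := (hT.sat_eq x).2
    simp only [Multiset.mem_cons, Multiset.mem_map, Finset.mem_val, Finset.mem_filter,
      Finset.mem_univ, true_and, forall_eq_or_imp, MPG.Sat, MPG.out] at hS
    constructor
    · intro hs
      obtain ⟨h0, h1⟩ := hS.1 hs
      refine ⟨h0.symm, fun c' hc' => ?_⟩
      rcases hc'.cases with h | ⟨w | c'', h2, h3, h4⟩
      · simp at h
      · exact h2.elim
      · have h3' : c'' ≠ c := by simpa using h3
        have h5 := h1 (f c'') ⟨c'', ⟨h2, h3'⟩, rfl⟩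
        exact (ih' c'' h2 h3').1 h5.1 (h5.2.trans h0.symm) c' h4
    · intro hx
      have hout : T.out x = x j := by
        obtain ⟨A, hA, hA'⟩ := (hT.sat_eq x).1
        simp only [Multiset.mem_cons, Multiset.mem_map, Finset.mem_val, Finset.mem_filter,
          Finset.mem_univ, true_and] at hA
        rcases hA with rfl | ⟨c', ⟨h1, h2⟩, rfl⟩
        · exact hA'.symm
        · rw [← hA', ((ih' c' h1 h2).2 hx).2]
      refine hS.2 ⟨hout.symm, ?_⟩
      rintro _ ⟨c', ⟨h1, h2⟩, rfl⟩
      have := (ih' c' h1 h2).2 hx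
      exact ⟨this.1, this.2.trans hout.symm⟩
  | check j c f T hf hT ih =>
    have ih' : ∀ j', H c j' ≠ 0 → j' ≠ j → BranchSpec H x (f j') (.inr c) (.inl j') :=
      fun c' h1 h2 => ih c' h1 h2 h1
    simp only [BranchSpec] at ih' ⊢
    obtain ⟨hO, hS⟩ := hT.sat_check x
    simp only [Multiset.mem_map, Finset.mem_val, Finset.mem_filter,
      Finset.mem_univ, true_and] at hS
    have hO' : T.Sat x → T.out x = ∑ i ∈ Finset.univ.filter (fun i => H c i ≠ 0 ∧ i ≠ j), x i := by
      intro hs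
      rw [hO, Multiset.map_map]
      refine Finset.sum_congr rfl fun i hi => ?_
      obtain ⟨h1, h2⟩ := (Finset.mem_filter.1 hi).2
      exact ((ih' i h1 h2).1 (hS.1 hs _ ⟨i, ⟨h1, h2⟩, rfl⟩)).1
    have hm := mulVec_eq_add_sum H x (c := c) (j := j) hp
    constructor
    · intro hs ho c' hc'
      rw [← hO' hs, ho, CharTwo.add_self_eq_zero] at hm
      rcases hc'.cases with h | ⟨j' | w, h2, h3, h4⟩
      · simp only [Sum.inr.injEq] at h
        rw [h, hm]
      · have h3' : j' ≠ j := by simpa using h3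
        exact ((ih' j' h2 h3').1 (hS.1 hs _ ⟨j', ⟨h2, h3'⟩, rfl⟩)).2 c' h4
      · exact h2.elim
    · intro hx
      have hs : T.Sat x := by
        refine hS.2 ?_
        rintro _ ⟨i, ⟨h1, h2⟩, rfl⟩
        exact (ih' i h1 h2).2 hx
      refine ⟨hs, ?_⟩
      rw [← hO' hs, hx] at hm
      exact (CharTwo.add_eq_zero.1 hm.symm).symm

/-- A tree that represents the code `C` with the bit `r` at its root. -/
structure Represents (C : Submodule (ZMod 2) (Fin n → ZMod 2)) (r : Fin n) (T : MPG n) : Prop where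
  nodup : T.leaves.Nodup
  mem_leaves : ∀ j, j ∈ T.leaves
  sat_iff : ∀ x, T.Sat x ↔ x ∈ C
  out_eq : ∀ x, T.Sat x → T.out x = x r

lemma represents_root {C : Submodule (ZMod 2) (Fin n → ZMod 2)} {r : Fin n} {B : MPG n}
    (hr : r ∉ B.leaves) (hB : B.leaves.Nodup) (hmem : ∀ j, j ≠ r → j ∈ B.leaves)
    (hsat : ∀ x, B.Sat x ∧ B.out x = x r ↔ x ∈ C) :
    Represents C r (.eq (.leaf r) B) ∧ Represents C r (.eq B (.leaf r)) := by
  have h1 : ((.leaf r : MPG n).leaves + B.leaves).Nodup := by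
    rw [MPG.leaves, Multiset.singleton_add, Multiset.nodup_cons]
    exact ⟨hr, hB⟩
  have h2 : ∀ j, j ∈ (.leaf r : MPG n).leaves + B.leaves := by
    intro j
    rw [MPG.leaves, Multiset.singleton_add, Multiset.mem_cons]
    exact or_iff_not_imp_left.2 (hmem j)
  constructor
  · refine ⟨h1, h2, fun x => ?_, fun x _ => rfl⟩
    rw [← hsat]
    simp only [MPG.Sat, MPG.out, true_and, eq_comm]
  · refine ⟨by rw [MPG.leaves, add_comm]; exact h1, fun j => by
      rw [MPG.leaves, add_comm]; exact h2 j, fun x => ?_, fun x hx => hx.2.2⟩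
    rw [← hsat]
    simp only [MPG.Sat, MPG.out, true_and]

theorem IsMPG.represents {C : Submodule (ZMod 2) (Fin n → ZMod 2)} {r : Fin n} {T : MPG n}
    (hT : IsMPG C r T) : Represents C r T := by
  obtain ⟨m, H, ⟨hC, hG⟩, f, hf, h⟩ := hT
  rcases h with ⟨h0, rfl⟩ | ⟨B, hB, h⟩
  -- A bit in no check is isolated, hence by connectedness the only node; there are no checks to
  -- satisfy.
  · have honly : ∀ u : Fin n ⊕ Fin m, u = .inl r := by
      intro u
      by_contra hu
      obtain ⟨w | c, hw, -⟩ := exists_behind hG.connected hu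
      · exact hw.elim
      · exact hw (h0 c)
    refine ⟨by simp [MPG.leaves], fun j => ?_, fun x => ?_, fun x _ => rfl⟩
    · have := honly (.inl j)
      simp only [Sum.inl.injEq] at this
      simp [MPG.leaves, this]
    · rw [hC]
      refine ⟨fun _ => ?_, fun _ => trivial⟩
      funext c
      have := honly (.inr c)
      simp at this
  · have hl : ∀ c, H c r ≠ 0 → _ := fun c hc => (hf c hc).leaves_spec hG.isAcyclic hc
    have hs : ∀ x c, H c r ≠ 0 → BranchSpec H x (f c) (.inl r) (.inr c) :=
      fun x c hc => (hf c hc).sat_spec hc x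
    have hmemB : ∀ j, j ∈ B.leaves ↔ ∃ c, H c r ≠ 0 ∧ j ∈ (f c).leaves := by
      intro j
      simp only [hB.leaves_eq, Multiset.bind_map, Multiset.mem_bind, Finset.mem_val,
        Finset.mem_filter, Finset.mem_univ, true_and]
    have key : Represents C r (.eq (.leaf r) B) ∧ Represents C r (.eq B (.leaf r)) := by
      refine represents_root ?_ ?_ ?_ ?_
      · rw [hmemB]
        rintro ⟨c, hc, h⟩
        exact not_behind_self _ _ (((hl c hc).2 r).1 h)
      · rw [hB.leaves_eq, Multiset.bind_map]
        refine nodup_bind_finset _ _ ?_ ?_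
        · simp only [Finset.mem_filter, Finset.mem_univ, true_and]
          exact fun c hc => (hl c hc).1
        · simp only [Finset.mem_filter, Finset.mem_univ, true_and]
          intro c' h1 c'' h2 i h3 h4
          rw [(hl _ h1).2] at h3
          rw [(hl _ h2).2] at h4
          exact Sum.inr_injective (h3.unique hG.isAcyclic (v := .inl r) h1 h2 h4)
      · intro j hj
        rw [hmemB]
        obtain ⟨w | c, hw, hb⟩ := exists_behind hG.connected (v := .inl r) (u := .inl j)
          (by simpa using hj)
        · exact hw.elim
        · exact ⟨c, hw, ((hl c hw).2 j).2 hb⟩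
      · intro x
        rw [hC]
        have hS := (hB.sat_eq x).2
        simp only [Multiset.mem_map, Finset.mem_val, Finset.mem_filter, Finset.mem_univ, true_and,
          forall_exists_index, and_imp, forall_apply_eq_imp_iff₂] at hS
        simp only [BranchSpec] at hs
        constructor
        · rintro ⟨h1, h2⟩
          funext c
          obtain ⟨w | c', hw, hb⟩ := exists_behind hG.connected (v := .inl r) (u := .inr c)
            (by simp)
          · exact hw.elim
          · have h3 := hS.1 h1 c' hw
            exact (hs x c' hw).1 h3.1 (h3.2.trans h2) c hb
        · intro hx
          have hout : B.out x = x r := by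
            obtain ⟨A, hA, hA'⟩ := (hB.sat_eq x).1
            simp only [Multiset.mem_map, Finset.mem_val, Finset.mem_filter,
              Finset.mem_univ, true_and] at hA
            obtain ⟨c', h1, rfl⟩ := hA
            rw [← hA', ((hs x c' h1).2 hx).2]
          refine ⟨hS.2 fun c hc => ?_, hout⟩
          have := (hs x c hc).2 hx
          exact ⟨this.1, this.2.trans hout.symm⟩
    rcases h with rfl | rfl
    · exact key.1
    · exact key.2

/-! ### Existence of message-passing graphs -/

lemma exists_branch {C : Submodule (ZMod 2) (Fin n → ZMod 2)}
    {H : Matrix (Fin m) (Fin n) (ZMod 2)} (hH : IsTreeParityCheck C H)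
    (hnz : ∀ j : Fin n, ∃ x ∈ C, x j ≠ 0) (N : ℕ) (p v : Fin n ⊕ Fin m)
    (hp : (tannerGraph H).Adj p v) (hN : {u | Behind (tannerGraph H) p v u}.ncard ≤ N) :
    ∃ T, Branch H p v T := by
  induction N generalizing p v with
  | zero =>
    have h1 : (Behind (tannerGraph H) p v) v := Behind.refl hp.ne
    have h2 := Set.ncard_pos (s := {u | Behind (tannerGraph H) p v u}) (Set.toFinite _) |>.2 ⟨v, h1⟩
    omega
  | succ N ih =>
    have hlt : ∀ w, (tannerGraph H).Adj v w → w ≠ p → ∃ T, Branch H v w T := by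
      intro w hw hne
      have := ncard_behind_lt hH.2.isAcyclic hp hw hne
      exact ih v w hw (by omega)
    match p, v with
    | .inl i, .inl j => exact hp.elim
    | .inr i, .inr j => exact hp.elim
    | .inr c, .inl j =>
      have h : ∀ c', ∃ T, H c' j ≠ 0 → c' ≠ c → Branch H (.inl j) (.inr c') T := by
        intro c'
        by_cases h1 : H c' j ≠ 0 ∧ c' ≠ c
        · obtain ⟨T, hT⟩ := hlt (.inr c') h1.1 (by simpa using h1.2)
          exact ⟨T, fun _ _ => hT⟩
        · exact ⟨.leaf j, fun h2 h3 => absurd ⟨h2, h3⟩ h1⟩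
      choose f hf using h
      obtain ⟨T, hT⟩ := exists_combines MPG.eq (MPG.leaf j ::ₘ
        (Finset.univ.filter fun c' => H c' j ≠ 0 ∧ c' ≠ c).val.map f) (by simp)
      exact ⟨T, .bit c j f T hf hT⟩
    | .inl j, .inr c =>
      have h : ∀ j', ∃ T, H c j' ≠ 0 → j' ≠ j → Branch H (.inr c) (.inl j') T := by
        intro j'
        by_cases h1 : H c j' ≠ 0 ∧ j' ≠ j
        · obtain ⟨T, hT⟩ := hlt (.inl j') h1.1 (by simpa using h1.2)
          exact ⟨T, fun _ _ => hT⟩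
        · exact ⟨.leaf j, fun h2 h3 => absurd ⟨h2, h3⟩ h1⟩
      choose f hf using h
      obtain ⟨T, hT⟩ := exists_combines MPG.check
        ((Finset.univ.filter fun j' => H c j' ≠ 0 ∧ j' ≠ j).val.map f) (by
          -- A check of degree one would force its bit to vanish on the code, so a check node always
          -- has a further neighbour to build from.
          intro h0
          rw [Multiset.map_eq_zero, Finset.val_eq_zero] at h0
          obtain ⟨x, hx, hxj⟩ := hnz j
          have h1 := congrFun ((hH.1 x).1 hx) c
          rw [mulVec_eq_add_sum H x (j := j) hp, h0, Finset.sum_empty, add_zero] at h1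
          exact hxj h1)
      exact ⟨T, .check j c f T hf hT⟩

theorem exists_isMPG {C : Submodule (ZMod 2) (Fin n → ZMod 2)} (hC : HasTreeTannerGraph C)
    (hnz : ∀ j : Fin n, ∃ x ∈ C, x j ≠ 0) (r : Fin n) : ∃ T, IsMPG C r T := by
  obtain ⟨m, H, hH⟩ := hC
  have h : ∀ c, ∃ T, H c r ≠ 0 → Branch H (.inl r) (.inr c) T := by
    intro c
    by_cases h1 : H c r ≠ 0
    · obtain ⟨T, hT⟩ := exists_branch hH hnz _ (.inl r) (.inr c) h1 le_rfl
      exact ⟨T, fun _ => hT⟩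
    · exact ⟨.leaf r, fun h2 => absurd h2 h1⟩
  choose f hf using h
  by_cases h0 : ∀ c, H c r = 0
  · exact ⟨_, m, H, hH, f, hf, Or.inl ⟨h0, rfl⟩⟩
  · obtain ⟨c, hc⟩ := not_forall.1 h0
    obtain ⟨B, hB⟩ := exists_combines MPG.eq
      ((Finset.univ.filter fun c => H c r ≠ 0).val.map f) (by
        intro h0
        rw [Multiset.map_eq_zero, Finset.val_eq_zero, Finset.filter_eq_empty_iff] at h0
        exact h0 (Finset.mem_univ c) hc)
    exact ⟨_, m, H, hH, f, hf, Or.inr ⟨B, hB, Or.inl rfl⟩⟩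

end MessagePassing

section FourierAnalysis

/-! ### Fourier analysis of linearly independent geometrically uniform states -/

lemma sgn_sum {ι : Type*} (S : Finset ι) (f : ι → ZMod 2) :
    sgn (∑ i ∈ S, f i) = ∏ i ∈ S, sgn (f i) := by
  classical
  induction S using Finset.induction with
  | empty => simp [sgn_zero]
  | insert a S ha ih => rw [Finset.sum_insert ha, Finset.prod_insert ha, sgn_add, ih]

variable {k : ℕ}

/-- Orthogonality of characters: the sum factors over the coordinates, and a coordinate where s and
t differ contributes 1 - 1 = 0. -/
lemma sum_sgn_mul_sgn (s t : Fin k → ZMod 2) :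
    ∑ m : Fin k → ZMod 2, sgn (m ⬝ᵥ s) * sgn (m ⬝ᵥ t) = if s = t then 2 ^ k else 0 := by
  have h1 : ∀ m : Fin k → ZMod 2, sgn (m ⬝ᵥ s) * sgn (m ⬝ᵥ t) =
      ∏ i, sgn (m i * (s i + t i)) := by
    intro m
    rw [← sgn_add, ← dotProduct_add, dotProduct, sgn_sum]
    rfl
  have h2 : ∑ m : Fin k → ZMod 2, ∏ i, sgn (m i * (s i + t i)) =
      ∏ i, ∑ a, sgn (a * (s i + t i)) := by
    rw [Finset.prod_univ_sum, Fintype.piFinset_univ]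
  have h3 : ∀ i, ∑ a, sgn (a * (s i + t i)) = if s i = t i then 2 else 0 := by
    intro i
    rw [sum_zmod_two]
    rcases zmod_two_cases (s i) with hs | hs <;> rcases zmod_two_cases (t i) with ht | ht <;>
      simp [hs, ht, sgn_zero, sgn_one, one_add_one_zmod_two] <;> norm_num
  simp only [h1, h2, h3]
  split_ifs with h
  · simp [h]
  · obtain ⟨i, hi⟩ := Function.ne_iff.1 h
    exact Finset.prod_eq_zero (Finset.mem_univ i) (if_neg hi)

section Fourier

variable {ι : Type*} [Fintype ι]

lemma trace_mul_ketbra (M : Matrix ι ι ℂ) (ψ : ι → ℂ) :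
    (M * ketbra ψ).trace = star ψ ⬝ᵥ M *ᵥ ψ := by
  rw [ketbra, mul_vecMulVec, trace_vecMulVec, dotProduct_comm]

lemma ketbra_mulVec (ψ φ : ι → ℂ) : ketbra ψ *ᵥ φ = (star ψ ⬝ᵥ φ) • ψ := by
  rw [ketbra, vecMulVec_mulVec]
  funext i
  simp [mul_comm]

lemma ketbra_conjTranspose {ι : Type*} (ψ : ι → ℂ) : (ketbra ψ)ᴴ = ketbra ψ := by
  rw [ketbra, conjTranspose_vecMulVec, star_star]

lemma mul_ketbra_mul {R : Matrix ι ι ℂ} (hR : Rᴴ = R) (ψ : ι → ℂ) :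
    R * ketbra ψ * R = ketbra (R *ᵥ ψ) := by
  rw [ketbra, ketbra, mul_vecMulVec, vecMulVec_mul, star_mulVec, hR]

/-- The functional calculus of a Hermitian matrix acts on eigenvectors by the function. -/
lemma cfc_mulVec_of_eigenvector [DecidableEq ι] {ρ : Matrix ι ι ℂ} (hρ : ρᴴ = ρ) (f : ℝ → ℝ)
    {c : ℝ} {v : ι → ℂ}
    (hv : ρ *ᵥ v = (c : ℂ) • v) : cfc f ρ *ᵥ v = (f c : ℂ) • v := by
  classical
  have hsa : IsSelfAdjoint ρ := hρ
  have hfin : (spectrum ℝ ρ).Finite := Matrix.finite_real_spectrum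
  -- On a finite spectrum, f agrees with an interpolation polynomial. Including c as a node makes
  -- the argument cover v = 0 too, where c need not be in the spectrum.
  let S : Finset ℝ := insert c hfin.toFinset
  let P : Polynomial ℝ := Lagrange.interpolate S id f
  have hP : ∀ x ∈ S, P.eval x = f x := fun x hx =>
    Lagrange.eval_interpolate_at_node (v := id) f Function.injective_id.injOn hx
  have h1 : cfc f ρ = Polynomial.aeval ρ P := by
    rw [← cfc_polynomial P ρ hsa]
    refine cfc_congr fun x hx => (hP x ?_).symm
    exact Finset.mem_insert_of_mem (hfin.mem_toFinset.2 hx)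
  have h2 : ∀ Q : Polynomial ℝ, Polynomial.aeval ρ Q *ᵥ v = ((Q.eval c : ℝ) : ℂ) • v := by
    intro Q
    induction Q using Polynomial.induction_on' with
    | add p q hp hq => rw [map_add, add_mulVec, hp, hq, Polynomial.eval_add,
        Complex.ofReal_add, add_smul]
    | monomial d a =>
      have hpow : ρ ^ d *ᵥ v = ((c : ℂ) ^ d) • v := by
        induction d with
        | zero => simp
        | succ d ih =>
          rw [pow_succ, ← mulVec_mulVec, hv, mulVec_smul, ih, smul_smul, pow_succ, mul_comm]
      rw [Polynomial.aeval_monomial, Polynomial.eval_monomial, ← mulVec_mulVec, hpow,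
        Matrix.algebraMap_eq_diagonal]
      funext i
      simp [mulVec_diagonal, mul_assoc]
  rw [h1, h2, hP c (Finset.mem_insert_self _ _)]

/-- The states with the Fourier components `ν s • u s`. -/
def fourierState (u : (Fin k → ZMod 2) → ι → ℂ) (ν : (Fin k → ZMod 2) → ℝ)
    (m : Fin k → ZMod 2) : ι → ℂ :=
  ∑ s, (sgn (m ⬝ᵥ s) * (ν s : ℂ)) • u s

/-- The family `u` is orthonormal. -/
def IsOrthonormal (u : (Fin k → ZMod 2) → ι → ℂ) : Prop :=
  ∀ s t, star (u s) ⬝ᵥ u t = if s = t then 1 else 0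

variable {u : (Fin k → ZMod 2) → ι → ℂ} {ν : (Fin k → ZMod 2) → ℝ}

lemma star_fourierState_dotProduct (hu : IsOrthonormal u) (m t : Fin k → ZMod 2) :
    star (fourierState u ν m) ⬝ᵥ u t = sgn (m ⬝ᵥ t) * (ν t : ℂ) := by
  rw [fourierState, star_sum, sum_dotProduct]
  simp only [star_smul, smul_dotProduct, hu _ t, star_mul', star_sgn]
  simp

lemma star_fourierState_dotProduct_fourierState (hu : IsOrthonormal u)
    (ν ν' : (Fin k → ZMod 2) → ℝ) (m m' : Fin k → ZMod 2) :
    star (fourierState u ν m) ⬝ᵥ fourierState u ν' m' =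
      ∑ s, sgn (s ⬝ᵥ m) * sgn (s ⬝ᵥ m') * ((ν s : ℂ) * ν' s) := by
  rw [fourierState.eq_1 u ν' m', dotProduct_sum]
  refine Finset.sum_congr rfl fun s _ => ?_
  rw [dotProduct_smul, star_fourierState_dotProduct hu, smul_eq_mul, dotProduct_comm m,
    dotProduct_comm m']
  ring

lemma star_fourierState_one (hu : IsOrthonormal u) (m m' : Fin k → ZMod 2) :
    star (fourierState u 1 m) ⬝ᵥ fourierState u 1 m' = if m = m' then 2 ^ k else 0 := by
  rw [star_fourierState_dotProduct_fourierState hu]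
  simp [sum_sgn_mul_sgn]

lemma sum_sgn_smul_fourierState {ι : Type*} {u : (Fin k → ZMod 2) → ι → ℂ}
    (ν : (Fin k → ZMod 2) → ℝ) (t : Fin k → ZMod 2) :
    ∑ m, sgn (m ⬝ᵥ t) • fourierState u ν m = ((2 : ℂ) ^ k * ν t) • u t := by
  simp only [fourierState, Finset.smul_sum]
  rw [Finset.sum_comm]
  have : ∀ s, ∑ m, sgn (m ⬝ᵥ t) • (sgn (m ⬝ᵥ s) * (ν s : ℂ)) • u s =
      (if t = s then 2 ^ k * (ν s : ℂ) else 0) • u s := by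
    intro s
    simp only [smul_smul, ← Finset.sum_smul, ← mul_assoc, ← Finset.sum_mul, sum_sgn_mul_sgn]
    split_ifs <;> simp
  simp only [this]
  simp

/-- The average of the states. -/
def fourierAverage (u : (Fin k → ZMod 2) → ι → ℂ) (ν : (Fin k → ZMod 2) → ℝ) : Matrix ι ι ℂ :=
  ∑ m, ((2 : ℂ) ^ k)⁻¹ • ketbra (fourierState u ν m)

lemma fourierAverage_conjTranspose {ι : Type*} {u : (Fin k → ZMod 2) → ι → ℂ} :
    (fourierAverage u ν)ᴴ = fourierAverage u ν := by
  rw [fourierAverage, conjTranspose_sum]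
  refine Finset.sum_congr rfl fun m _ => ?_
  rw [conjTranspose_smul, ketbra_conjTranspose]
  simp

/-- Averaging over m kills all cross terms between different components, so the average is diagonal
in `u`. -/
lemma fourierAverage_mulVec (hu : IsOrthonormal u) (t : Fin k → ZMod 2) :
    fourierAverage u ν *ᵥ u t = ((ν t ^ 2 : ℝ) : ℂ) • u t := by
  rw [fourierAverage, sum_mulVec]
  simp only [smul_mulVec, ketbra_mulVec, star_fourierState_dotProduct hu, mul_comm _ (ν t : ℂ),
    mul_smul]
  rw [← Finset.smul_sum, ← Finset.smul_sum, sum_sgn_smul_fourierState, smul_smul, smul_smul]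
  congr 1
  push_cast
  field_simp

lemma invSqrt_fourierAverage_mulVec [DecidableEq ι] (hu : IsOrthonormal u) (hν : ∀ s, 0 < ν s)
    (m : Fin k → ZMod 2) :
    invSqrt (fourierAverage u ν) *ᵥ fourierState u ν m = fourierState u 1 m := by
  rw [fourierState, mulVec_sum]
  refine Finset.sum_congr rfl fun s _ => ?_
  rw [mulVec_smul, invSqrt, cfc_mulVec_of_eigenvector fourierAverage_conjTranspose _
    (fourierAverage_mulVec hu s), Real.sqrt_sq (hν s).le, smul_smul]
  have : (ν s : ℂ) ≠ 0 := by exact_mod_cast (hν s).ne'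
  congr 1
  push_cast
  simp [this]

/-- The projections onto the Fourier transform of the orthonormal family `u`. -/
def fourierProj (u : (Fin k → ZMod 2) → ι → ℂ) (m : Fin k → ZMod 2) : Matrix ι ι ℂ :=
  ((2 : ℂ) ^ k)⁻¹ • ketbra (fourierState u 1 m)

lemma invSqrt_conjTranspose [DecidableEq ι] (ρ : Matrix ι ι ℂ) : (invSqrt ρ)ᴴ = invSqrt ρ :=
  cfc_predicate (p := IsSelfAdjoint) (fun t : ℝ => (Real.sqrt t)⁻¹) ρ

lemma pgm_eq_fourierProj [DecidableEq ι] (hu : IsOrthonormal u) (hν : ∀ s, 0 < ν s)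
    (m : Fin k → ZMod 2) :
    ((2 : ℂ) ^ k)⁻¹ • (invSqrt (fourierAverage u ν) * ketbra (fourierState u ν m) *
      invSqrt (fourierAverage u ν)) = fourierProj u m := by
  rw [mul_ketbra_mul (invSqrt_conjTranspose _), invSqrt_fourierAverage_mulVec hu hν, fourierProj]

lemma fourierProj_conjTranspose {ι : Type*} {u : (Fin k → ZMod 2) → ι → ℂ}
    (m : Fin k → ZMod 2) : (fourierProj u m)ᴴ = fourierProj u m := by
  rw [fourierProj, conjTranspose_smul, ketbra_conjTranspose]
  simp

lemma fourierProj_mulVec (hu : IsOrthonormal u) (m m' : Fin k → ZMod 2) :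
    fourierProj u m *ᵥ fourierState u 1 m' = if m = m' then fourierState u 1 m' else 0 := by
  rw [fourierProj, smul_mulVec, ketbra_mulVec, star_fourierState_one hu]
  split_ifs with h
  · subst h; simp [smul_smul]
  · simp

lemma fourierProj_mul (hu : IsOrthonormal u) (m m' : Fin k → ZMod 2) :
    fourierProj u m * fourierProj u m' = if m = m' then fourierProj u m else 0 := by
  have h := fourierProj_mulVec hu m m'
  rw [fourierProj.eq_1 u m', Matrix.mul_smul, ketbra, mul_vecMulVec, h]
  split_ifs with h
  · subst h; rfl
  · simp

/-- The inverse square root of the average turns the states into orthogonal nonzero vectors. -/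
lemma linearIndependent_fourierState [DecidableEq ι] (hu : IsOrthonormal u) (hν : ∀ s, 0 < ν s) :
    LinearIndependent ℂ (fourierState u ν) := by
  rw [Fintype.linearIndependent_iff]
  intro g hg m
  have h1 := congrArg (fun v => star (fourierState u 1 m) ⬝ᵥ (invSqrt (fourierAverage u ν) *ᵥ v)) hg
  simp only [mulVec_sum, mulVec_smul, invSqrt_fourierAverage_mulVec hu hν, dotProduct_sum,
    dotProduct_smul, star_fourierState_one hu, mulVec_zero, dotProduct_zero] at h1
  simpa using h1

/-- Two operators that agree on the Fourier transform of `u` agree on all states. -/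
lemma mulVec_fourierState_congr {K E : Matrix ι ι ℂ}
    (h : ∀ m, K *ᵥ fourierState u 1 m = E *ᵥ fourierState u 1 m) (m : Fin k → ZMod 2) :
    K *ᵥ fourierState u ν m = E *ᵥ fourierState u ν m := by
  have h1 : ∀ t, K *ᵥ u t = E *ᵥ u t := by
    intro t
    have h2 := sum_sgn_smul_fourierState (u := u) 1 t
    have h3 : u t = ((2 : ℂ) ^ k)⁻¹ • ∑ m, sgn (m ⬝ᵥ t) • fourierState u 1 m := by
      rw [h2]; simp [smul_smul]
    rw [h3]
    simp only [mulVec_smul, mulVec_sum, h]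
  simp only [fourierState, mulVec_sum, mulVec_smul, h1]

lemma star_dotProduct_fourierProj (hu : IsOrthonormal u) (m : Fin k → ZMod 2) :
    star (fourierState u ν m) ⬝ᵥ fourierProj u m *ᵥ fourierState u ν m =
      ((((2 : ℝ) ^ k)⁻¹ * (∑ s, ν s) ^ 2 : ℝ) : ℂ) := by
  rw [fourierProj, smul_mulVec, ketbra_mulVec, dotProduct_smul, dotProduct_smul,
    star_fourierState_dotProduct_fourierState hu, star_fourierState_dotProduct_fourierState hu]
  simp only [sgn_mul_self]
  simp [sq]

/-! ### Optimality of the Fourier basis measurement -/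

lemma re_star_dotProduct_conjTranspose_mul (B : Matrix ι ι ℂ) (ψ : ι → ℂ) :
    (star ψ ⬝ᵥ (Bᴴ * B) *ᵥ ψ).re = ∑ i, ‖(B *ᵥ ψ) i‖ ^ 2 := by
  rw [← mulVec_mulVec, dotProduct_mulVec, ← star_mulVec, dotProduct, Complex.re_sum]
  refine Finset.sum_congr rfl fun i _ => ?_
  rw [Pi.star_apply, ← Complex.normSq_eq_norm_sq, Complex.normSq_apply]
  simp

lemma norm_sgn (a : ZMod 2) : ‖sgn a‖ = 1 := by
  rcases zmod_two_cases a with rfl | rfl <;> simp [sgn_zero, sgn_one]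

open scoped ComplexOrder in
-- With F = B†B, the triangle inequality removes the signs, and Cauchy–Schwarz with weights ν gives
-- a bound that does not depend on m and is linear in F, so it can be summed over the measurement.
lemma posSemidef_fourierState_le {F : Matrix ι ι ℂ} (hF : F.PosSemidef) (hν : ∀ s, 0 < ν s)
    (m : Fin k → ZMod 2) : (star (fourierState u ν m) ⬝ᵥ F *ᵥ fourierState u ν m).re ≤
      (∑ s, ν s) * ∑ s, ν s * (star (u s) ⬝ᵥ F *ᵥ u s).re := by
  obtain ⟨B, rfl⟩ : ∃ B : Matrix ι ι ℂ, F = Bᴴ * B := by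
    classical
    open scoped MatrixOrder in exact CStarAlgebra.nonneg_iff_eq_star_mul_self.mp hF.nonneg
  simp only [re_star_dotProduct_conjTranspose_mul]
  have key : ∀ i, ‖(B *ᵥ fourierState u ν m) i‖ ^ 2 ≤
      (∑ s, ν s) * ∑ s, ν s * ‖(B *ᵥ u s) i‖ ^ 2 := by
    intro i
    have h1 : ‖(B *ᵥ fourierState u ν m) i‖ ≤ ∑ s, ν s * ‖(B *ᵥ u s) i‖ := by
      rw [fourierState, mulVec_sum, Finset.sum_apply]
      refine (norm_sum_le _ _).trans (le_of_eq (Finset.sum_congr rfl fun s _ => ?_))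
      rw [mulVec_smul, Pi.smul_apply, norm_smul, norm_mul, norm_sgn, Complex.norm_real, one_mul,
        Real.norm_of_nonneg (hν s).le]
    refine (pow_le_pow_left₀ (norm_nonneg _) h1 2).trans ?_
    refine Finset.sum_sq_le_sum_mul_sum_of_sq_le_mul _ (fun s _ => (hν s).le)
      (fun s _ => mul_nonneg (hν s).le (sq_nonneg _)) fun s _ => le_of_eq ?_
    ring
  refine (Finset.sum_le_sum fun i _ => key i).trans (le_of_eq ?_)
  rw [← Finset.mul_sum, Finset.sum_comm]
  simp only [Finset.mul_sum]

open scoped ComplexOrder in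
/-- No measurement identifies the states better than the Fourier basis measurement. -/
lemma sum_star_dotProduct_le [DecidableEq ι] (hu : IsOrthonormal u) (hν : ∀ s, 0 < ν s)
    (F : (Fin k → ZMod 2) → Matrix ι ι ℂ) (hF : ∀ m, (F m).PosSemidef)
    (hF' : (1 - ∑ m, F m).PosSemidef) :
    ∑ m, (star (fourierState u ν m) ⬝ᵥ F m *ᵥ fourierState u ν m).re ≤ (∑ s, ν s) ^ 2 := by
  -- The elements sum to at most the identity, and u s is a unit vector.
  have h1 : ∀ s, ∑ m, (star (u s) ⬝ᵥ F m *ᵥ u s).re ≤ 1 := by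
    intro s
    have h2 := (Complex.le_def.1 (hF'.dotProduct_mulVec_nonneg (u s))).1
    rw [sub_mulVec, one_mulVec, dotProduct_sub, hu, if_pos rfl, sum_mulVec, dotProduct_sum] at h2
    simp only [Complex.sub_re, Complex.re_sum, Complex.zero_re, Complex.one_re] at h2
    linarith
  calc _ ≤ ∑ m, (∑ s, ν s) * ∑ s, ν s * (star (u s) ⬝ᵥ F m *ᵥ u s).re :=
        Finset.sum_le_sum fun m _ => posSemidef_fourierState_le (hF m) hν m
    _ = (∑ s, ν s) * ∑ s, ν s * ∑ m, (star (u s) ⬝ᵥ F m *ᵥ u s).re := by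
        rw [← Finset.mul_sum, Finset.sum_comm]
        simp only [Finset.mul_sum]
    _ ≤ (∑ s, ν s) * ∑ s, ν s * 1 := by
        refine mul_le_mul_of_nonneg_left (Finset.sum_le_sum fun s _ =>
          mul_le_mul_of_nonneg_left (h1 s) (hν s).le) (Finset.sum_nonneg fun s _ => (hν s).le)
    _ = _ := by simp [sq]

open scoped ComplexOrder in
lemma fourierProj_posSemidef (hu : IsOrthonormal u) (m : Fin k → ZMod 2) :
    (fourierProj u m).PosSemidef := by
  have h := fourierProj_mul hu m m
  rw [if_pos rfl] at h
  have h2 := posSemidef_conjTranspose_mul_self (fourierProj u m)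
  rwa [fourierProj_conjTranspose, h] at h2

open scoped ComplexOrder in
lemma one_sub_sum_fourierProj_posSemidef [DecidableEq ι] (hu : IsOrthonormal u) :
    (1 - ∑ m, fourierProj u m).PosSemidef := by
  have h1 : (∑ m, fourierProj u m) * ∑ m, fourierProj u m = ∑ m, fourierProj u m := by
    simp only [Finset.sum_mul, Finset.mul_sum, fourierProj_mul hu]
    simp
  have h2 : (1 - ∑ m, fourierProj u m)ᴴ * (1 - ∑ m, fourierProj u m) =
      1 - ∑ m, fourierProj u m := by
    rw [conjTranspose_sub, conjTranspose_one, conjTranspose_sum]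
    simp only [fourierProj_conjTranspose]
    rw [sub_mul, mul_sub, mul_sub, h1]
    simp
  rw [← h2]
  exact posSemidef_conjTranspose_mul_self _

/-! ### Sequential measurements -/

lemma reverse_prod_mulVec [DecidableEq ι] {k : ℕ} (M : Fin k → Matrix ι ι ℂ)
    (c : Fin k → ℂ) (v : ι → ℂ)
    (h : ∀ i, M i *ᵥ v = c i • v) :
    (List.ofFn M).reverse.prod *ᵥ v = (∏ i, c i) • v := by
  induction k with
  | zero => simp
  | succ k ih =>
    rw [List.ofFn_succ, List.reverse_cons, List.prod_append, List.prod_singleton,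
      ← mulVec_mulVec, h, mulVec_smul, ih _ (fun i => c i.succ) fun i => h i.succ, smul_smul,
      Fin.prod_univ_succ]

lemma sum_reverse_prod [DecidableEq ι] {k : ℕ} (M : Fin k → ZMod 2 → Matrix ι ι ℂ)
    (h : ∀ i, ∑ b, (M i b)ᴴ * M i b = 1) :
    ∑ b : Fin k → ZMod 2, ((List.ofFn fun i => M i (b i)).reverse.prod)ᴴ *
      (List.ofFn fun i => M i (b i)).reverse.prod = 1 := by
  induction k with
  | zero => simp
  | succ k ih =>
    rw [← (Fin.consEquiv fun _ => ZMod 2).sum_comp, Fintype.sum_prod_type]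
    have key : ∀ (a : ZMod 2) (b : Fin k → ZMod 2),
        (List.ofFn fun i => M i ((Fin.consEquiv fun _ => ZMod 2) (a, b) i)).reverse.prod =
        (List.ofFn fun i : Fin k => M i.succ (b i)).reverse.prod * M 0 a := by
      intro a b
      rw [List.ofFn_succ, List.reverse_cons, List.prod_append, List.prod_singleton]
      simp [Fin.consEquiv]
    simp only [key, conjTranspose_mul]
    -- The first measurement is the rightmost factor, so the sum over all later outcomes, which is 1
    -- by induction, sits between (M 0 a)† and M 0 a.
    rw [← h 0]
    refine Finset.sum_congr rfl fun a _ => ?_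
    have h2 := ih (fun i => M i.succ) fun i => h i.succ
    calc _ = (M 0 a)ᴴ * (∑ b : Fin k → ZMod 2,
          ((List.ofFn fun i => M i.succ (b i)).reverse.prod)ᴴ *
            (List.ofFn fun i => M i.succ (b i)).reverse.prod) * M 0 a := by
          simp only [Finset.mul_sum, Finset.sum_mul, Matrix.mul_assoc]
      _ = _ := by rw [h2, Matrix.mul_one]

end Fourier

end FourierAnalysis

section Decoding

/-! ### The output states of a code -/

variable {n k : ℕ} {C : Submodule (ZMod 2) (Fin n → ZMod 2)} {r : Fin k → Fin n}

lemma eq_of_forall_dotProduct_eq {s t : Fin k → ZMod 2} (h : ∀ y, y ⬝ᵥ s = y ⬝ᵥ t) : s = t := by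
  funext i
  simpa using h (Pi.single i 1)

/-- The codeword with given bits at the positions of an information set. -/
def infoEquiv (hr : IsInformationSet C r) : C ≃ₗ[ZMod 2] (Fin k → ZMod 2) :=
  LinearEquiv.ofBijective
    ({ toFun := fun x i => x.1 (r i)
       map_add' := fun _ _ => rfl
       map_smul' := fun _ _ => rfl } : C →ₗ[ZMod 2] (Fin k → ZMod 2)) hr

/-- The class of a label modulo the dual code, in the coordinates of an information set. -/
def dualClass (hr : IsInformationSet C r) (z : Fin n → ZMod 2) : Fin k → ZMod 2 :=
  fun i => ((infoEquiv hr).symm (Pi.single i 1)).1 ⬝ᵥ z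

lemma dotProduct_dualClass (hr : IsInformationSet C r) (x : C) (z : Fin n → ZMod 2) :
    infoEquiv hr x ⬝ᵥ dualClass hr z = x.1 ⬝ᵥ z := by
  obtain ⟨y, rfl⟩ := (infoEquiv hr).symm.surjective x
  rw [LinearEquiv.apply_symm_apply]
  conv_rhs => rw [pi_eq_sum_univ' y]
  rw [map_sum, Submodule.coe_sum, sum_dotProduct, dotProduct]
  refine Finset.sum_congr rfl fun i _ => ?_
  rw [map_smul, Submodule.coe_smul, smul_dotProduct, dualClass, smul_eq_mul]

lemma dualClass_eq_iff (hr : IsInformationSet C r) (z z' : Fin n → ZMod 2) :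
    dualClass hr z = dualClass hr z' ↔ ∀ x ∈ C, x ⬝ᵥ z = x ⬝ᵥ z' := by
  constructor
  · intro h x hx
    rw [← dotProduct_dualClass hr ⟨x, hx⟩ z, h, dotProduct_dualClass]
  · intro h
    refine eq_of_forall_dotProduct_eq fun y => ?_
    obtain ⟨x, rfl⟩ := (infoEquiv hr).surjective y
    rw [dotProduct_dualClass, dotProduct_dualClass, h _ x.2]

/-- Flipping the label at r i changes x·z by the bit of x there, which is the i-th information bit.
-/
lemma dualClass_add_single (hr : IsInformationSet C r) (z : Fin n → ZMod 2) (i : Fin k) :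
    dualClass hr (z + Pi.single (r i) 1) = dualClass hr z + Pi.single i 1 := by
  refine eq_of_forall_dotProduct_eq fun y => ?_
  obtain ⟨x, rfl⟩ := (infoEquiv hr).surjective y
  rw [dotProduct_add, dotProduct_dualClass, dotProduct_dualClass, dotProduct_add,
    dotProduct_single_one, dotProduct_single_one]
  rfl

lemma dualClass_surjective (hr : IsInformationSet C r) : Function.Surjective (dualClass hr) := by
  intro s
  -- The representative is s itself, written on the information positions.
  refine ⟨∑ i, s i • Pi.single (r i) 1, eq_of_forall_dotProduct_eq fun y => ?_⟩
  obtain ⟨x, rfl⟩ := (infoEquiv hr).surjective y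
  rw [dotProduct_dualClass, dotProduct_sum, dotProduct]
  refine Finset.sum_congr rfl fun i _ => ?_
  rw [dotProduct_smul, dotProduct_single_one, smul_eq_mul, mul_comm]
  rfl

/-- The absolute value of the amplitude of an output state at the label `z`. -/
def ampProd (θ : Fin n → ℝ) (z : Fin n → ZMod 2) : ℝ := ∏ i, amp (θ i) (z i)

lemma ampProd_pos {θ : Fin n → ℝ} (hθ : ∀ j, θ j ∈ Set.Ioo 0 Real.pi) (z : Fin n → ZMod 2) :
    0 < ampProd θ z := Finset.prod_pos fun i _ => amp_pos (hθ i) _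

lemma outputState_apply (θ : Fin n → ℝ) (x z : Fin n → ZMod 2) :
    outputState θ x z = sgn (x ⬝ᵥ z) * (ampProd θ z : ℂ) := by
  rw [outputState, dotProduct, sgn_sum, ampProd, Complex.ofReal_prod, ← Finset.prod_mul_distrib]
  refine Finset.prod_congr rfl fun i _ => ?_
  rcases zmod_two_cases (z i) with h | h <;> simp [h, qstate, sgn]

/-- The component of the output states in a class modulo the dual code. -/
def classVec (hr : IsInformationSet C r) (θ : Fin n → ℝ) (s : Fin k → ZMod 2) :
    (Fin n → ZMod 2) → ℂ :=
  fun z => if dualClass hr z = s then (ampProd θ z : ℂ) else 0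

/-- The norm of `classVec`. -/
def classNorm (hr : IsInformationSet C r) (θ : Fin n → ℝ) (s : Fin k → ZMod 2) : ℝ :=
  Real.sqrt (∑ z, if dualClass hr z = s then ampProd θ z ^ 2 else 0)

/-- The normalization of `classVec`. -/
def classUnit (hr : IsInformationSet C r) (θ : Fin n → ℝ) (s : Fin k → ZMod 2) :
    (Fin n → ZMod 2) → ℂ :=
  ((classNorm hr θ s : ℂ))⁻¹ • classVec hr θ s

lemma classNorm_pos (hr : IsInformationSet C r) {θ : Fin n → ℝ}
    (hθ : ∀ j, θ j ∈ Set.Ioo 0 Real.pi) (s : Fin k → ZMod 2) : 0 < classNorm hr θ s := by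
  obtain ⟨z, rfl⟩ := dualClass_surjective hr s
  refine Real.sqrt_pos.2 (Finset.sum_pos' (fun w _ => by split_ifs <;> positivity)
    ⟨z, Finset.mem_univ z, ?_⟩)
  rw [if_pos rfl]
  exact pow_pos (ampProd_pos hθ z) 2

lemma star_classVec_dotProduct (hr : IsInformationSet C r) (θ : Fin n → ℝ)
    (s t : Fin k → ZMod 2) : star (classVec hr θ s) ⬝ᵥ classVec hr θ t =
      if s = t then ((classNorm hr θ s ^ 2 : ℝ) : ℂ) else 0 := by
  rw [dotProduct]
  split_ifs with h
  · subst h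
    rw [classNorm, Real.sq_sqrt (Finset.sum_nonneg fun w _ => by split_ifs <;> positivity),
      Complex.ofReal_sum]
    refine Finset.sum_congr rfl fun z _ => ?_
    simp only [classVec, Pi.star_apply]
    split_ifs <;> simp [sq]
  · refine Finset.sum_eq_zero fun z _ => ?_
    simp only [classVec, Pi.star_apply]
    split_ifs with h1 h2
    · exact absurd (h1.symm.trans h2) h
    all_goals simp

lemma isOrthonormal_classUnit (hr : IsInformationSet C r) {θ : Fin n → ℝ}
    (hθ : ∀ j, θ j ∈ Set.Ioo 0 Real.pi) : IsOrthonormal (classUnit hr θ) := by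
  intro s t
  rw [classUnit, classUnit, star_smul, smul_dotProduct, dotProduct_smul,
    star_classVec_dotProduct]
  have : (classNorm hr θ s : ℂ) ≠ 0 := by exact_mod_cast (classNorm_pos hr hθ s).ne'
  split_ifs with h
  · subst h
    simp
    field_simp
  · simp

lemma outputState_eq_fourierState (hr : IsInformationSet C r) {θ : Fin n → ℝ}
    (hθ : ∀ j, θ j ∈ Set.Ioo 0 Real.pi) (x : C) :
    outputState θ x.1 = fourierState (classUnit hr θ) (classNorm hr θ) (infoEquiv hr x) := by
  funext z
  have h1 : ∀ s, (classNorm hr θ s : ℂ) ≠ 0 := fun s => by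
    exact_mod_cast (classNorm_pos hr hθ s).ne'
  simp only [fourierState, classUnit, smul_smul, mul_assoc, mul_inv_cancel₀ (h1 _), mul_one,
    Finset.sum_apply, Pi.smul_apply, classVec, smul_eq_mul, mul_ite, mul_zero, Finset.sum_ite_eq,
    Finset.mem_univ, if_true]
  rw [outputState_apply, dotProduct_dualClass]

/-! ### The measurement of one bit -/

namespace Represents

variable {i : Fin k} {T : MPG n}

/-- The transpose of the syndrome map has range C, so equal syndromes mean equal products with all
codewords. -/
lemma syndrome_eq_iff (hr : IsInformationSet C r) (hT : Represents C (r i) T)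
    (z z' : Fin n → ZMod 2) : T.syndrome z = T.syndrome z' ↔ dualClass hr z = dualClass hr z' := by
  rw [dualClass_eq_iff]
  constructor
  · intro h x hx
    obtain ⟨y, rfl⟩ := T.exists_encode_eq hT.nodup x ((hT.sat_iff x).2 hx)
    rw [← T.dotProduct_syndrome hT.nodup, h, T.dotProduct_syndrome hT.nodup]
  · intro h
    refine eq_of_forall_dotProduct_eq fun y => ?_
    rw [T.dotProduct_syndrome hT.nodup, T.dotProduct_syndrome hT.nodup]
    exact h _ ((hT.sat_iff _).1 (T.sat_encode_and_out hT.nodup y).1)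

/-- Transposed, this says that the codeword encoded from y has the value of y at the data wire as
its bit j, which is the output of the root. -/
lemma syndrome_add_single {j : Fin n} (hT : Represents C j T) (z : Fin n → ZMod 2) :
    T.syndrome (z + Pi.single j 1) = T.syndrome z + Pi.single T.dataWire 1 := by
  refine eq_of_forall_dotProduct_eq fun y => ?_
  obtain ⟨h1, h2⟩ := T.sat_encode_and_out hT.nodup y
  rw [dotProduct_add, T.dotProduct_syndrome hT.nodup, T.dotProduct_syndrome hT.nodup,
    dotProduct_add, dotProduct_single_one, dotProduct_single_one, ← h2, hT.out_eq _ h1]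

lemma leaves_eq {j : Fin n} (hT : Represents C j T) : T.leaves = Finset.univ.val :=
  (Multiset.Nodup.ext hT.nodup Finset.univ.nodup).2 fun a => by simp [hT.mem_leaves a]

lemma syndromeVec_eq (hr : IsInformationSet C r) (hT : Represents C (r i) T) (θ : Fin n → ℝ)
    (z : Fin n → ZMod 2) : T.syndromeVec θ (T.syndrome z) = classVec hr θ (dualClass hr z) := by
  funext w
  simp only [MPG.syndromeVec, classVec, hT.syndrome_eq_iff hr, MPG.weight, hT.leaves_eq, ampProd]
  rfl

lemma circuit_mulVec_classUnit (hr : IsInformationSet C r) (hT : Represents C (r i) T)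
    {θ : Fin n → ℝ} (hθ : ∀ j, θ j ∈ Set.Ioo 0 Real.pi) (z : Fin n → ZMod 2) :
    T.circuit θ *ᵥ classUnit hr θ (dualClass hr z) = Pi.single (T.syndrome z) 1 := by
  have h1 := T.circuit_mulVec_syndromeVec θ hθ hT.nodup (T.syndrome z)
  rw [hT.syndromeVec_eq hr] at h1
  have hU := mem_unitaryGroup_iff'.1 (T.circuit_mem_unitaryGroup θ hθ hT.nodup)
  have h2 : star (T.circuit θ *ᵥ classVec hr θ (dualClass hr z)) ⬝ᵥ
      (T.circuit θ *ᵥ classVec hr θ (dualClass hr z)) =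
      star (classVec hr θ (dualClass hr z)) ⬝ᵥ classVec hr θ (dualClass hr z) := by
    rw [star_mulVec, ← dotProduct_mulVec, mulVec_mulVec, ← star_eq_conjTranspose, hU, one_mulVec]
  rw [star_classVec_dotProduct, if_pos rfl, h1] at h2
  -- No closed formula for the amplitude is needed: it is nonnegative, and the unitary preserves the
  -- norm.
  have h3 : T.outAmp θ (T.syndrome z) = classNorm hr θ (dualClass hr z) := by
    rw [← pow_left_inj₀ (T.outAmp_nonneg θ hθ _) (classNorm_pos hr hθ _).le two_ne_zero,
      ← Complex.ofReal_inj, ← h2]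
    simp [sq]
  have h4 : (classNorm hr θ (dualClass hr z) : ℂ) ≠ 0 := by
    exact_mod_cast (classNorm_pos hr hθ _).ne'
  rw [classUnit, mulVec_smul, h1, h3, smul_smul, inv_mul_cancel₀ h4, one_smul]

lemma conjTranspose_circuit_mulVec (hr : IsInformationSet C r) (hT : Represents C (r i) T)
    {θ : Fin n → ℝ} (hθ : ∀ j, θ j ∈ Set.Ioo 0 Real.pi) (z : Fin n → ZMod 2) :
    (T.circuit θ)ᴴ *ᵥ Pi.single (T.syndrome z) 1 = classUnit hr θ (dualClass hr z) := by
  have hU := mem_unitaryGroup_iff'.1 (T.circuit_mem_unitaryGroup θ hθ hT.nodup)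
  rw [← hT.circuit_mulVec_classUnit hr hθ, mulVec_mulVec, ← star_eq_conjTranspose, hU, one_mulVec]

lemma bitStep_mulVec_classUnit (hr : IsInformationSet C r) (hT : Represents C (r i) T)
    {θ : Fin n → ℝ} (hθ : ∀ j, θ j ∈ Set.Ioo 0 Real.pi) (b : ZMod 2) (s : Fin k → ZMod 2) :
    bitStep θ T b *ᵥ classUnit hr θ s =
      (1 / 2 : ℂ) • (classUnit hr θ s + sgn b • classUnit hr θ (s + Pi.single i 1)) := by
  obtain ⟨z, rfl⟩ := dualClass_surjective hr s
  rw [bitStep, ← mulVec_mulVec, ← mulVec_mulVec, hT.circuit_mulVec_classUnit hr hθ,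
    onQubit_pmProjection_mulVec_single, mulVec_smul, mulVec_add, mulVec_smul,
    hT.conjTranspose_circuit_mulVec hr hθ, ← hT.syndrome_add_single,
    hT.conjTranspose_circuit_mulVec hr hθ, dualClass_add_single]

/-- Translation by e_i multiplies the Fourier vector of m by (-1)^{m_i}, so the step has the
eigenvalue (1 + (-1)^{b + m_i})/2. -/
lemma bitStep_mulVec_fourierState (hr : IsInformationSet C r) (hT : Represents C (r i) T)
    {θ : Fin n → ℝ} (hθ : ∀ j, θ j ∈ Set.Ioo 0 Real.pi) (b : ZMod 2) (m : Fin k → ZMod 2) :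
    bitStep θ T b *ᵥ fourierState (classUnit hr θ) 1 m =
      (if b = m i then 1 else 0 : ℂ) • fourierState (classUnit hr θ) 1 m := by
  have h1 : bitStep θ T b *ᵥ fourierState (classUnit hr θ) 1 m =
      (1 / 2 : ℂ) • (fourierState (classUnit hr θ) 1 m +
        sgn b • ∑ s, sgn (m ⬝ᵥ s) • classUnit hr θ (s + Pi.single i 1)) := by
    simp only [fourierState, mulVec_sum, mulVec_smul, hT.bitStep_mulVec_classUnit hr hθ,
      Finset.smul_sum, ← Finset.sum_add_distrib, Pi.one_apply, Complex.ofReal_one, mul_one]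
    refine Finset.sum_congr rfl fun s _ => ?_
    rw [smul_comm, smul_add, smul_comm (sgn b)]
  have h2 : ∑ s, sgn (m ⬝ᵥ s) • classUnit hr θ (s + Pi.single i 1) =
      sgn (m i) • fourierState (classUnit hr θ) 1 m := by
    rw [← Equiv.sum_comp (Equiv.addRight (Pi.single i 1 : Fin k → ZMod 2)), fourierState,
      Finset.smul_sum]
    refine Finset.sum_congr rfl fun s _ => ?_
    have h3 : s + Pi.single i 1 + Pi.single i 1 = s := by
      rw [add_assoc, ← Pi.single_add, one_add_one_zmod_two, Pi.single_zero, add_zero]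
    simp only [Equiv.coe_addRight, h3, dotProduct_add, dotProduct_single_one, sgn_add, smul_smul,
      Pi.one_apply, Complex.ofReal_one, mul_one]
    rw [mul_comm]
  rw [h1, h2, smul_smul, ← sgn_add]
  rcases zmod_two_cases b with rfl | rfl <;> rcases zmod_two_cases (m i) with h | h <;>
    simp [h, sgn_zero, sgn_one, one_add_one_zmod_two]
  all_goals rw [← two_smul ℂ, smul_smul]; norm_num

end Represents

lemma sum_bitStep {θ : Fin n → ℝ} {T : MPG n}
    (hU : T.circuit θ ∈ unitaryGroup (Fin n → ZMod 2) ℂ) :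
    ∑ b, (bitStep θ T b)ᴴ * bitStep θ T b = 1 := by
  have h1 := mem_unitaryGroup_iff.1 hU
  have h2 := mem_unitaryGroup_iff'.1 hU
  rw [star_eq_conjTranspose] at h1 h2
  have h3 : ∀ b, (bitStep θ T b)ᴴ * bitStep θ T b = (T.circuit θ)ᴴ *
      ((onQubit T.dataWire (pmProjection b))ᴴ * onQubit T.dataWire (pmProjection b)) *
        T.circuit θ := by
    intro b
    simp only [bitStep, conjTranspose_mul, conjTranspose_conjTranspose, Matrix.mul_assoc]
    rw [← Matrix.mul_assoc (T.circuit θ) (T.circuit θ)ᴴ, h1, Matrix.one_mul]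
  simp only [h3]
  rw [← Finset.sum_mul, ← Finset.mul_sum, sum_onQubit_pmProjection, Matrix.mul_one, h2]

lemma bpqmOperator_mulVec_fourierState (hr : IsInformationSet C r) {T : Fin k → MPG n}
    (hT : ∀ i, Represents C (r i) (T i)) {θ : Fin n → ℝ} (hθ : ∀ j, θ j ∈ Set.Ioo 0 Real.pi)
    (b m : Fin k → ZMod 2) :
    bpqmOperator θ T b *ᵥ fourierState (classUnit hr θ) 1 m =
      fourierProj (classUnit hr θ) b *ᵥ fourierState (classUnit hr θ) 1 m := by
  rw [bpqmOperator, reverse_prod_mulVec _ _ _ fun i =>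
    (hT i).bitStep_mulVec_fourierState hr hθ (b i) m,
    fourierProj_mulVec (isOrthonormal_classUnit hr hθ), Finset.prod_ite_zero]
  have h : (∀ i ∈ Finset.univ, b i = m i) ↔ b = m := by simp [funext_iff]
  simp only [h, Finset.prod_const_one]
  split_ifs <;> simp

/-! ### The pretty-good measurement and optimality -/

section pgm

variable [Fintype C]

lemma card_eq_two_pow (hr : IsInformationSet C r) : Fintype.card C = 2 ^ k := by
  rw [Fintype.card_congr (infoEquiv hr).toEquiv, Fintype.card_fun, ZMod.card, Fintype.card_fin]

lemma averageState_eq (hr : IsInformationSet C r) {θ : Fin n → ℝ}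
    (hθ : ∀ j, θ j ∈ Set.Ioo 0 Real.pi) :
    averageState C θ = fourierAverage (classUnit hr θ) (classNorm hr θ) := by
  rw [averageState, fourierAverage, ← (infoEquiv hr).toEquiv.sum_comp, card_eq_two_pow hr]
  refine Finset.sum_congr rfl fun x _ => ?_
  rw [outputState_eq_fourierState hr hθ]
  push_cast
  rfl

lemma pgmElement_eq (hr : IsInformationSet C r) {θ : Fin n → ℝ}
    (hθ : ∀ j, θ j ∈ Set.Ioo 0 Real.pi) (x : C) :
    pgmElement C θ x = fourierProj (classUnit hr θ) (infoEquiv hr x) := by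
  rw [pgmElement, averageState_eq hr hθ, outputState_eq_fourierState hr hθ, card_eq_two_pow hr,
    ← pgm_eq_fourierProj (isOrthonormal_classUnit hr hθ) (classNorm_pos hr hθ)]
  push_cast
  rfl

lemma successProb_pgmElement (hr : IsInformationSet C r) {θ : Fin n → ℝ}
    (hθ : ∀ j, θ j ∈ Set.Ioo 0 Real.pi) :
    successProb C θ (pgmElement C θ) =
      (Fintype.card C : ℝ)⁻¹ * (∑ s, classNorm hr θ s) ^ 2 := by
  rw [successProb]
  congr 1
  simp only [trace_mul_ketbra, pgmElement_eq hr hθ, outputState_eq_fourierState hr hθ,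
    star_dotProduct_fourierProj (isOrthonormal_classUnit hr hθ), Complex.ofReal_re,
    Finset.sum_const, Finset.card_univ, card_eq_two_pow hr, nsmul_eq_mul]
  push_cast
  field_simp

lemma successProb_le (hr : IsInformationSet C r) {θ : Fin n → ℝ}
    (hθ : ∀ j, θ j ∈ Set.Ioo 0 Real.pi) (F : C → Matrix (Fin n → ZMod 2) (Fin n → ZMod 2) ℂ)
    (hF : IsDecoder C F) : successProb C θ F ≤ successProb C θ (pgmElement C θ) := by
  rw [successProb_pgmElement hr hθ, successProb]
  refine mul_le_mul_of_nonneg_left ?_ (by positivity)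
  simp only [trace_mul_ketbra, outputState_eq_fourierState hr hθ]
  have h := sum_star_dotProduct_le (isOrthonormal_classUnit hr hθ) (classNorm_pos hr hθ)
    (fun m => F ((infoEquiv hr).symm m)) (fun m => hF.1 _) (by
      have := hF.2
      rwa [← (infoEquiv hr).symm.toEquiv.sum_comp] at this)
  rw [← (infoEquiv hr).toEquiv.sum_comp] at h
  simpa using h

theorem isBlockOptimal_pgmElement (hr : IsInformationSet C r) {θ : Fin n → ℝ}
    (hθ : ∀ j, θ j ∈ Set.Ioo 0 Real.pi) : IsBlockOptimal C θ (pgmElement C θ) := by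
  have hu := isOrthonormal_classUnit hr hθ
  refine ⟨⟨fun x => ?_, ?_⟩, successProb_le hr hθ⟩
  · rw [pgmElement_eq hr hθ]
    exact fourierProj_posSemidef hu _
  · have := one_sub_sum_fourierProj_posSemidef hu
    rw [← (infoEquiv hr).toEquiv.sum_comp] at this
    simp only [pgmElement_eq hr hθ]
    exact this

theorem pgmElement_mul (hr : IsInformationSet C r) {θ : Fin n → ℝ}
    (hθ : ∀ j, θ j ∈ Set.Ioo 0 Real.pi) (x y : C) :
    pgmElement C θ x * pgmElement C θ y = if x = y then pgmElement C θ x else 0 := by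
  simp only [pgmElement_eq hr hθ, fourierProj_mul (isOrthonormal_classUnit hr hθ),
    EmbeddingLike.apply_eq_iff_eq]

end pgm

theorem linearIndependent_outputState (hr : IsInformationSet C r) {θ : Fin n → ℝ}
    (hθ : ∀ j, θ j ∈ Set.Ioo 0 Real.pi) :
    LinearIndependent ℂ (fun x : C => outputState θ x.1) := by
  have h := (linearIndependent_fourierState (isOrthonormal_classUnit hr hθ)
    (classNorm_pos hr hθ)).comp _ (infoEquiv hr).injective
  convert h using 1
  funext x
  exact outputState_eq_fourierState hr hθ x

/-- The phase flips by the bits of a label, as a homomorphism to the unitary group. -/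
def phaseFlip (n : ℕ) :
    Multiplicative (Fin n → ZMod 2) →* unitaryGroup (Fin n → ZMod 2) ℂ where
  toFun x := ⟨diagonal fun z => sgn (x.toAdd ⬝ᵥ z), by
    rw [mem_unitaryGroup_iff, star_eq_conjTranspose, diagonal_conjTranspose, diagonal_mul_diagonal,
      ← diagonal_one]
    congr 1
    funext z
    rw [Pi.star_apply, star_sgn, sgn_mul_self]⟩
  map_one' := by
    ext1
    simp [sgn_zero]
  map_mul' x y := by
    ext1
    simp [add_dotProduct, sgn_add]

theorem isGeometricallyUniform_outputState (C : Submodule (ZMod 2) (Fin n → ZMod 2))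
    (θ : Fin n → ℝ) :
    IsGeometricallyUniform (Set.range fun x : C => outputState θ x.1) := by
  refine ⟨(AddSubgroup.toSubgroup C.toAddSubgroup).map (phaseFlip n), outputState θ 0,
    Set.Finite.image _ (Set.toFinite _), ?_, ?_⟩
  · rintro _ ⟨x, -, rfl⟩ _ ⟨y, -, rfl⟩
    rw [← map_mul, ← map_mul, mul_comm]
  · have key : ∀ x : Fin n → ZMod 2,
        (phaseFlip n (Multiplicative.ofAdd x)).1 *ᵥ outputState θ 0 = outputState θ x := by
      intro x
      funext z
      simp [phaseFlip, mulVec_diagonal, outputState_apply, sgn_zero]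
    ext ψ
    constructor
    · rintro ⟨x, rfl⟩
      exact ⟨_, ⟨Multiplicative.ofAdd x.1, x.2, rfl⟩, (key x.1).symm⟩
    · rintro ⟨_, ⟨x, hx, rfl⟩, rfl⟩
      exact ⟨⟨x.toAdd, hx⟩, (key x.toAdd).symm⟩

/-! ### BPQM as a measurement -/

section decoder

variable [Fintype C] {T : Fin k → MPG n} {θ : Fin n → ℝ}

theorem bpqmOperator_mulVec_outputState (hr : IsInformationSet C r)
    (hT : ∀ i, Represents C (r i) (T i)) (hθ : ∀ j, θ j ∈ Set.Ioo 0 Real.pi) (x y : C) :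
    (bpqmOperator θ T fun i => y.1 (r i)) *ᵥ outputState θ x.1 =
      pgmElement C θ y *ᵥ outputState θ x.1 := by
  rw [pgmElement_eq hr hθ, outputState_eq_fourierState hr hθ]
  exact mulVec_fourierState_congr (fun m => bpqmOperator_mulVec_fourierState hr hT hθ _ m) _

/-- The probability is the squared norm of K|Ψ⟩ = E|Ψ⟩, and E is a Hermitian projection, so this is
⟨Ψ|E|Ψ⟩. -/
theorem trace_bpqmElement_mul_ketbra (hr : IsInformationSet C r)
    (hT : ∀ i, Represents C (r i) (T i)) (hθ : ∀ j, θ j ∈ Set.Ioo 0 Real.pi) (x y : C) :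
    (bpqmElement θ r T y * ketbra (outputState θ x.1)).trace =
      (pgmElement C θ y * ketbra (outputState θ x.1)).trace := by
  have h1 := pgmElement_mul hr hθ y y
  rw [if_pos rfl] at h1
  have h2 : (pgmElement C θ y)ᴴ = pgmElement C θ y := by
    rw [pgmElement_eq hr hθ, fourierProj_conjTranspose]
  rw [trace_mul_ketbra, trace_mul_ketbra, bpqmElement, ← mulVec_mulVec, dotProduct_mulVec,
    ← star_mulVec, bpqmOperator_mulVec_outputState hr hT hθ, star_mulVec, h2,
    ← dotProduct_mulVec, mulVec_mulVec, h1]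

theorem sum_bpqmElement (hr : IsInformationSet C r)
    (hU : ∀ i, (T i).circuit θ ∈ unitaryGroup (Fin n → ZMod 2) ℂ) :
    ∑ x : C, bpqmElement θ r T x = 1 := by
  rw [← sum_reverse_prod (fun i => bitStep θ (T i)) fun i => sum_bitStep (hU i),
    ← (infoEquiv hr).toEquiv.sum_comp]
  rfl

open scoped ComplexOrder in
theorem isBlockOptimal_bpqmElement (hr : IsInformationSet C r)
    (hT : ∀ i, Represents C (r i) (T i)) (hθ : ∀ j, θ j ∈ Set.Ioo 0 Real.pi) :
    IsBlockOptimal C θ (fun x : C => bpqmElement θ r T x) := by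
  refine ⟨⟨fun x => posSemidef_conjTranspose_mul_self _, ?_⟩, fun F hF => ?_⟩
  · rw [sum_bpqmElement hr fun i => (T i).circuit_mem_unitaryGroup θ hθ (hT i).nodup, sub_self]
    exact PosSemidef.zero
  · refine (successProb_le hr hθ F hF).trans (le_of_eq ?_)
    simp only [successProb, trace_bpqmElement_mul_ketbra hr hT hθ]

end decoder

end Decoding

end BPQM

end

theorem theorem4p1 {n k : ℕ} (C : Submodule (ZMod 2) (Fin n → ZMod 2)) [Fintype C]
    (hC : BPQM.HasTreeTannerGraph C) (hnz : ∀ j : Fin n, ∃ x ∈ C, x j ≠ 0)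
    (θ : Fin n → ℝ) (hθ : ∀ j, θ j ∈ Set.Ioo 0 Real.pi)
    (r : Fin k → Fin n) (hr : BPQM.IsInformationSet C r) :
    -- the output states are geometrically uniform and linearly independent
    BPQM.IsGeometricallyUniform (Set.range fun x : C => BPQM.outputState θ x.1) ∧
    LinearIndependent ℂ (fun x : C => BPQM.outputState θ x.1) ∧
    -- the pretty-good measurement is projective and optimal
    (∀ x y : C, BPQM.pgmElement C θ x * BPQM.pgmElement C θ y =
      if x = y then BPQM.pgmElement C θ x else 0) ∧
    BPQM.IsBlockOptimal C θ (BPQM.pgmElement C θ) ∧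
    -- every bit has a message-passing graph
    (∀ j : Fin n, ∃ T, BPQM.IsMPG C j T) ∧
    -- BPQM, with any choice of the message-passing graphs
    ∀ T : Fin k → BPQM.MPG n, (∀ i, BPQM.IsMPG C (r i) (T i)) →
      (∀ i, (T i).circuit θ ∈ Matrix.unitaryGroup (Fin n → ZMod 2) ℂ) ∧
      -- it acts on the output states as the pretty-good measurement does
      (∀ x y : C, (BPQM.bpqmOperator θ T fun i => y.1 (r i)).mulVec (BPQM.outputState θ x.1) =
        (BPQM.pgmElement C θ y).mulVec (BPQM.outputState θ x.1)) ∧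
      (∀ x y : C,
        (BPQM.bpqmElement θ r T y * BPQM.ketbra (BPQM.outputState θ x.1)).trace =
          (BPQM.pgmElement C θ y * BPQM.ketbra (BPQM.outputState θ x.1)).trace) ∧
      -- it never fails to output a codeword, and it is block optimal
      (∑ x : C, BPQM.bpqmElement θ r T x = 1) ∧
      BPQM.IsBlockOptimal C θ (fun x : C => BPQM.bpqmElement θ r T x) := by
  have hrep : ∀ T : Fin k → BPQM.MPG n, (∀ i, BPQM.IsMPG C (r i) (T i)) →
      ∀ i, BPQM.Represents C (r i) (T i) := fun T hT i => (hT i).represents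
  have hU : ∀ T : Fin k → BPQM.MPG n, (∀ i, BPQM.IsMPG C (r i) (T i)) →
      ∀ i, (T i).circuit θ ∈ Matrix.unitaryGroup (Fin n → ZMod 2) ℂ :=
    fun T hT i => (T i).circuit_mem_unitaryGroup θ hθ (hrep T hT i).nodup
  exact ⟨BPQM.isGeometricallyUniform_outputState C θ, BPQM.linearIndependent_outputState hr hθ,
    BPQM.pgmElement_mul hr hθ, BPQM.isBlockOptimal_pgmElement hr hθ, BPQM.exists_isMPG hC hnz,
    fun T hT => ⟨hU T hT, BPQM.bpqmOperator_mulVec_outputState hr (hrep T hT) hθ,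
      BPQM.trace_bpqmElement_mul_ketbra hr (hrep T hT) hθ, BPQM.sum_bpqmElement hr (hU T hT),
      BPQM.isBlockOptimal_bpqmElement hr (hrep T hT) hθ⟩⟩
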